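/- \textbf{Proposition.} Let $\mathfrak{sl}_3$ be the Lie algebra of all complex $3\times 3$ matrices of trace zero, $U(\mathfrak{sl}_3)$ its universal enveloping algebra, and let $$X_1=E_{12},\quad X_2=E_{23},\quad X_3=E_{13},\quad Y_1=E_{21},\quad Y_2=E_{32},\quad Y_3=E_{31},\quad H_1=E_{11}-E_{22},\quad H_2=E_{22}-E_{33}$$ be the standard basis of $\mathfrak{sl}_3$, where the $E_{ij}$ are the matrix units, regarded as elements of $U(\mathfrak{sl}_3)$. Then the monomials $$Y_1^{j_1} Y_2^{j_2} Y_3^{j_3} X_1^{\ell_1} X_2^{\ell_2} X_3^{\ell_3} H_1^{r_1} H_2^{r_2},$$ where $j_1,j_2,j_3,\ell_1,\ell_2,\ell_3,r_1,r_2$ are non-negative integers such that $j_2\ell_2=0$ and $r_2\le 2$, form a basis of $U(\mathfrak{sl}_3)$ as a module over its center. -/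

import Mathlib

noncomputable section

namespace SlThree

-- the commutator bracket on an associative ring, used for matrices and for the enveloping algebra
attribute [local instance 100] LieRing.ofAssociativeRing

open LieAlgebra.SpecialLinear (single singleSubSingle)

/-- The Lie algebra of trace-zero complex `3 × 3` matrices (rows and columns indexed by 0, 1, 2). -/
abbrev sl3 : LieSubalgebra ℂ (Matrix (Fin 3) (Fin 3) ℂ) :=
  LieAlgebra.SpecialLinear.sl (Fin 3) ℂ

/-- The universal enveloping algebra of `sl3`. -/
abbrev U : Type := UniversalEnvelopingAlgebra ℂ sl3

/-- The center of the universal enveloping algebra. -/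
abbrev Z : Subalgebra ℂ U := Subalgebra.center ℂ U

/-- The canonical map from `sl3` to its universal enveloping algebra. -/
abbrev toU (A : sl3) : U := UniversalEnvelopingAlgebra.ι ℂ A

/-- `E₁₂` -/
def X₁ : U := toU (single 0 1 (by decide) 1)
/-- `E₂₃` -/
def X₂ : U := toU (single 1 2 (by decide) 1)
/-- `E₁₃` -/
def X₃ : U := toU (single 0 2 (by decide) 1)
/-- `E₂₁` -/
def Y₁ : U := toU (single 1 0 (by decide) 1)
/-- `E₃₂` -/
def Y₂ : U := toU (single 2 1 (by decide) 1)
/-- `E₃₁` -/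
def Y₃ : U := toU (single 2 0 (by decide) 1)
/-- `E₁₁ - E₂₂` -/
def H₁ : U := toU (singleSubSingle 0 1 1)
/-- `E₂₂ - E₃₃` -/
def H₂ : U := toU (singleSubSingle 1 2 1)

/-- The admissible tuples of exponents: `j₂ ℓ₂ = 0` and `r₂ ≤ 2`. -/
@[ext]
structure Exponents where
  j₁ : ℕ
  j₂ : ℕ
  j₃ : ℕ
  l₁ : ℕ
  l₂ : ℕ
  l₃ : ℕ
  r₁ : ℕ
  r₂ : ℕ
  j₂_mul_l₂ : j₂ * l₂ = 0
  r₂_le : r₂ ≤ 2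

/-- The monomial of `U` (factors in the displayed order) with the given exponents. -/
def monomial (e : Exponents) : U :=
  Y₁ ^ e.j₁ * Y₂ ^ e.j₂ * Y₃ ^ e.j₃ * X₁ ^ e.l₁ * X₂ ^ e.l₂ * X₃ ^ e.l₃ * H₁ ^ e.r₁ * H₂ ^ e.r₂

end SlThree

end

/-! Give Y₁, Y₂, Y₃, X₁, X₂, X₃, H₁, H₂ the weights 3, 5, 3, 3, 5, 3, 3, 4. Reordering a word costs
only shorter and lighter words. The quadratic Casimir element has leading term 2Y₂X₂; the cubic one,
after adding 3/2 times the trace-free part of E₁₁ times the quadratic one, has leading term H₂³/9.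
Induction on weight therefore writes every word of length d through the products `casimir₂ ^ i *
casimir₃ ^ k * monomial e` of degree at most d (`prod_mem_centralSpan`).

The leading exponents of these products are pairwise distinct, so in degree at most d there are no
more of them than ordered monomials. Ordered monomials are independent (`linearIndependent_ordProd`,
the Poincaré–Birkhoff–Witt theorem), so a dimension count makes the products a ℂ-basis of U
(`linearIndependent_centralMul`, `span_centralMul`).

It remains to see that the products of powers of the Casimir elements span the center
(`mem_span_casimir_pow`). The symbol of a central element is Poisson-invariant, hence constant under
unipotent conjugation. The generic matrix can be conjugated into a slice on which invariance under a
torus leaves only polynomials in the traces of the square and the cube (`IsInvariant.eq_aeval`).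
Subtracting the corresponding polynomial in the Casimir elements lowers the degree. Expanding
central coefficients in Casimir powers then turns the ℂ-basis into a basis over the center. -/

noncomputable section

namespace SlThree

attribute [local instance 100] LieRing.ofAssociativeRing

open LieAlgebra.SpecialLinear (single singleSubSingle)
open MvPolynomial (X C)

/-! ### Words filtered by length and weight -/

section LowerSpan

variable {ι A : Type*} [Ring A] [Algebra ℂ A]

/-- The span of the products of words of length `< d` and weight `< n`. -/
def lowerSpan (g : ι → A) (w : ι → ℕ) (d n : ℕ) : Submodule ℂ A :=
  Submodule.span ℂ {x | ∃ L : List ι, L.length < d ∧ (L.map w).sum < n ∧ (L.map g).prod = x}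

variable {g : ι → A} {w : ι → ℕ}

theorem prod_mem_lowerSpan {d n : ℕ} (L : List ι) (hd : L.length < d) (hn : (L.map w).sum < n) :
    (L.map g).prod ∈ lowerSpan g w d n :=
  Submodule.subset_span ⟨L, hd, hn, rfl⟩

theorem lowerSpan_mono {d n d' n' : ℕ} (hd : d ≤ d') (hn : n ≤ n') :
    lowerSpan g w d n ≤ lowerSpan g w d' n' := by
  refine Submodule.span_mono ?_
  rintro _ ⟨L, h₁, h₂, rfl⟩
  exact ⟨L, by omega, by omega, rfl⟩

theorem lowerSpan_le {d n : ℕ} {P : Submodule ℂ A}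
    (h : ∀ L : List ι, L.length < d → (L.map w).sum < n → (L.map g).prod ∈ P) :
    lowerSpan g w d n ≤ P := by
  refine Submodule.span_le.2 ?_
  rintro _ ⟨L, h₁, h₂, rfl⟩
  exact h L h₁ h₂

/-- Both bounds are strict, so concatenation needs only (d - 1) + (d' - 1) ≤ d'' - 1; this is the
slack of one in the hypotheses. -/
theorem mul_mem_lowerSpan {d n d' n' d'' n'' : ℕ} {x y : A} (hx : x ∈ lowerSpan g w d n)
    (hy : y ∈ lowerSpan g w d' n') (hd : d + d' ≤ d'' + 1) (hn : n + n' ≤ n'' + 1) :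
    x * y ∈ lowerSpan g w d'' n'' := by
  have h : lowerSpan g w d n * lowerSpan g w d' n' ≤ lowerSpan g w d'' n'' := by
    rw [lowerSpan, lowerSpan, Submodule.span_mul_span, Submodule.span_le]
    rintro _ ⟨_, ⟨L, h₁, h₂, rfl⟩, _, ⟨L', h₁', h₂', rfl⟩, rfl⟩
    refine Submodule.subset_span ⟨L ++ L', ?_, ?_, by simp⟩
    · simp only [List.length_append]; omega
    · simp only [List.map_append, List.sum_append]; omega
  exact h (Submodule.mul_mem_mul hx hy)

theorem prod_mul_mem_lowerSpan {d n d' n' : ℕ} (L : List ι) {x : A} (hx : x ∈ lowerSpan g w d n)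
    (hd : L.length + d ≤ d') (hn : (L.map w).sum + n ≤ n') :
    (L.map g).prod * x ∈ lowerSpan g w d' n' :=
  mul_mem_lowerSpan (prod_mem_lowerSpan L (Nat.lt_succ_self _) (Nat.lt_succ_self _)) hx
    (by omega) (by omega)

theorem mul_prod_mem_lowerSpan {d n d' n' : ℕ} (L : List ι) {x : A} (hx : x ∈ lowerSpan g w d n)
    (hd : L.length + d ≤ d') (hn : (L.map w).sum + n ≤ n') :
    x * (L.map g).prod ∈ lowerSpan g w d' n' :=
  mul_mem_lowerSpan hx (prod_mem_lowerSpan L (Nat.lt_succ_self _) (Nat.lt_succ_self _))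
    (by omega) (by omega)

/-- Permuting a word changes its product by a combination of shorter words of lower weight. -/
theorem prod_sub_prod_mem_lowerSpan_of_perm
    (hg : ∀ i j, g i * g j - g j * g i ∈ lowerSpan g w 2 (w i + w j)) {L L' : List ι}
    (h : L.Perm L') :
    (L.map g).prod - (L'.map g).prod ∈ lowerSpan g w L.length (L.map w).sum := by
  induction h with
  | nil => simp
  | @cons x l l' _ ih =>
    have := prod_mul_mem_lowerSpan (d' := (x :: l).length) (n' := ((x :: l).map w).sum) [x] ih
      (by simp; omega) (by simp)
    simpa [mul_sub] using this
  | swap x y l =>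
    have := mul_prod_mem_lowerSpan (d' := (y :: x :: l).length)
      (n' := ((y :: x :: l).map w).sum) l (hg y x) (by simp) (by simp; omega)
    simpa [sub_mul, mul_assoc] using this
  | trans h₁ _ ih₁ ih₂ =>
    rw [← h₁.length_eq, ← (h₁.map w).sum_eq] at ih₂
    simpa using add_mem ih₁ ih₂

end LowerSpan

/-! ### The standard basis, its structure constants and weights -/

/-- The standard basis of `sl3`, in the order used for the monomials. -/
def genSl : Fin 8 → sl3 :=
  ![single 1 0 (by decide) 1, single 2 1 (by decide) 1, single 2 0 (by decide) 1,
    single 0 1 (by decide) 1, single 1 2 (by decide) 1, single 0 2 (by decide) 1,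
    singleSubSingle 0 1 1, singleSubSingle 1 2 1]

/-- The generators of `U` in the order `Y₁, Y₂, Y₃, X₁, X₂, X₃, H₁, H₂`. -/
def gen (i : Fin 8) : U := toU (genSl i)

/-- The standard basis of `sl3` as integer matrices. -/
def genInt : Fin 8 → Matrix (Fin 3) (Fin 3) ℤ :=
  ![!![0, 0, 0; 1, 0, 0; 0, 0, 0], !![0, 0, 0; 0, 0, 0; 0, 1, 0], !![0, 0, 0; 0, 0, 0; 1, 0, 0],
    !![0, 1, 0; 0, 0, 0; 0, 0, 0], !![0, 0, 0; 0, 0, 1; 0, 0, 0], !![0, 0, 1; 0, 0, 0; 0, 0, 0],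
    !![1, 0, 0; 0, -1, 0; 0, 0, 0], !![0, 0, 0; 0, 1, 0; 0, 0, -1]]

/-- The coordinates of a trace-zero matrix in the standard basis. -/
def coord {R : Type*} [AddCommMonoid R] (M : Matrix (Fin 3) (Fin 3) R) : Fin 8 → R :=
  ![M 1 0, M 2 1, M 2 0, M 0 1, M 1 2, M 0 2, M 0 0, M 0 0 + M 1 1]

/-- The structure constants of `sl3`. -/
def structConst (i j k : Fin 8) : ℤ := coord (genInt i * genInt j - genInt j * genInt i) k

/-- The weights of the generators. -/
def wt : Fin 8 → ℕ := ![3, 5, 3, 3, 5, 3, 3, 4]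

/-- This makes commutators lower-order terms. The values of `wt` are chosen to satisfy it while Y₂X₂
(weight 10) dominates the quadratic Casimir element and H₂³ (weight 12) the corrected cubic one. -/
theorem wt_lt_of_structConst_ne_zero :
    ∀ i j k, structConst i j k ≠ 0 → wt k < wt i + wt j := by
  decide +kernel

theorem genSl_val (i : Fin 8) : (genSl i).val = (genInt i).map (Int.castRingHom ℂ) := by
  ext a b
  fin_cases i <;> fin_cases a <;> fin_cases b <;>
    simp [genSl, genInt, Matrix.single]

theorem coord_map {R R' : Type*} [Semiring R] [Semiring R'] (f : R →+* R')
    (M : Matrix (Fin 3) (Fin 3) R) (k : Fin 8) : coord (M.map f) k = f (coord M k) := by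
  fin_cases k <;> simp [coord]

theorem eq_sum_coord (M : sl3) : M = ∑ k, coord M.val k • genSl k := by
  have h : M.val 0 0 + M.val 1 1 + M.val 2 2 = 0 := by
    have := M.2
    simpa [sl3, LieAlgebra.SpecialLinear.sl, Matrix.trace, Fin.sum_univ_three] using this
  have h' : M.val 2 2 = -(M.val 0 0 + M.val 1 1) := by linear_combination h
  ext a b
  simp only [Fin.sum_univ_eight]
  fin_cases a <;> fin_cases b <;>
    simp [coord, genSl, Matrix.single, h']

theorem toU_eq_sum (M : sl3) : toU M = ∑ k, coord M.val k • gen k := by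
  conv_lhs => rw [eq_sum_coord M]
  simp [toU, gen]

theorem coord_lie_genSl (i j k : Fin 8) :
    coord (⁅genSl i, genSl j⁆ : sl3).val k = (structConst i j k : ℂ) := by
  rw [LieAlgebra.SpecialLinear.sl_bracket, genSl_val, genSl_val, ← Matrix.map_mul,
    ← Matrix.map_mul, ← Matrix.map_sub _ (by simp), coord_map]
  rfl

theorem gen_commutator (i j : Fin 8) :
    gen i * gen j - gen j * gen i = ∑ k, (structConst i j k : ℂ) • gen k := by
  have h : gen i * gen j - gen j * gen i = toU ⁅genSl i, genSl j⁆ := by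
    rw [toU, LieHom.map_lie]; rfl
  rw [h, toU_eq_sum]
  simp only [coord_lie_genSl]

theorem gen_commutator_mem_lowerSpan (i j : Fin 8) :
    gen i * gen j - gen j * gen i ∈ lowerSpan gen wt 2 (wt i + wt j) := by
  rw [gen_commutator]
  refine Submodule.sum_mem _ fun k _ => ?_
  by_cases h : structConst i j k = 0
  · simp [h]
  · refine Submodule.smul_mem _ _ ?_
    have := prod_mem_lowerSpan (g := gen) (w := wt) (d := 2) (n := wt i + wt j) [k] (by simp)
      (by simpa using wt_lt_of_structConst_ne_zero i j k h)
    simpa using this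

/-! ### A faithful enough representation by twisted vector fields -/

/-- The symmetric algebra of `sl3`. -/
abbrev S : Type := MvPolynomial (Fin 8) ℂ

/-- Polynomials in the entries of a `3 × 3` matrix with coefficients in `S`. -/
abbrev R : Type := MvPolynomial (Fin 3 × Fin 3) S

/-- The generic matrix. -/
def generic : Matrix (Fin 3) (Fin 3) R := Matrix.of fun i j => X (i, j)

/-- The embedding of the constants. -/
def const : ℂ →+* R := C.comp C

theorem const_apply (c : ℂ) : const c = C (C c) := rfl

theorem smul_eq_const_mul (c : ℂ) (f : R) : c • f = const c * f := by
  rw [Algebra.smul_def, IsScalarTower.algebraMap_apply ℂ S R, MvPolynomial.algebraMap_eq,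
    MvPolynomial.algebraMap_eq, const_apply]

/-- The vector field on the space of matrices which at the point `Y` takes the value
`(1 + Y) * M`. -/
def vf (M : Matrix (Fin 3) (Fin 3) ℂ) : Derivation S R R :=
  MvPolynomial.mkDerivation S fun p => ((1 + generic) * M.map const) p.1 p.2

theorem vf_X (M : Matrix (Fin 3) (Fin 3) ℂ) (i j : Fin 3) :
    vf M (X (i, j)) = ((1 + generic) * M.map const) i j := by
  simp [vf]

theorem vf_const (M : Matrix (Fin 3) (Fin 3) ℂ) (c : ℂ) : vf M (const c) = 0 :=
  MvPolynomial.derivation_C _ _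

theorem vf_add (M N : Matrix (Fin 3) (Fin 3) ℂ) : vf (M + N) = vf M + vf N := by
  refine MvPolynomial.derivation_ext fun ⟨i, j⟩ => ?_
  rw [Derivation.add_apply, vf_X, vf_X, vf_X, Matrix.map_add _ (by simp), mul_add,
    Matrix.add_apply]

set_option synthInstance.maxHeartbeats 200000 in
theorem vf_smul (c : ℂ) (M : Matrix (Fin 3) (Fin 3) ℂ) (f : R) : vf (c • M) f = c • vf M f := by
  have : vf (c • M) = (C c : S) • vf M := by
    refine MvPolynomial.derivation_ext fun ⟨i, j⟩ => ?_
    rw [Derivation.smul_apply, vf_X, vf_X, MvPolynomial.smul_eq_C_mul, ← const_apply]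
    simp only [Matrix.mul_apply, Matrix.map_apply, Matrix.smul_apply, smul_eq_mul, map_mul,
      Finset.mul_sum]
    exact Finset.sum_congr rfl fun k _ => by ring
  rw [this, Derivation.smul_apply, MvPolynomial.smul_eq_C_mul, smul_eq_const_mul, const_apply]

theorem vf_vf_X (M N : Matrix (Fin 3) (Fin 3) ℂ) (i j : Fin 3) :
    vf N (vf M (X (i, j))) = ((1 + generic) * (N * M).map const) i j := by
  have h : ∀ a b, vf N ((1 + generic) a b) = ((1 + generic) * N.map const) a b := by
    intro a b
    rw [← vf_X, Matrix.add_apply, map_add, Matrix.one_apply]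
    split_ifs <;> simp [generic]
  rw [vf_X, Matrix.mul_apply, map_sum, Matrix.map_mul, ← mul_assoc, Matrix.mul_apply]
  refine Finset.sum_congr rfl fun k _ => ?_
  rw [Derivation.leibniz, h, Matrix.map_apply, vf_const]
  simp [mul_comm]

theorem vf_lie (M N : Matrix (Fin 3) (Fin 3) ℂ) : vf (M * N - N * M) = ⁅vf M, vf N⁆ := by
  refine MvPolynomial.derivation_ext fun ⟨i, j⟩ => ?_
  rw [Derivation.commutator_apply, vf_vf_X, vf_vf_X, vf_X, Matrix.map_sub _ (by simp), mul_sub,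
    Matrix.sub_apply]

/-- The phase function. -/
def phase : R := ∑ k, C (X k) * coord generic k

/-- The vector field `vf M` conjugated by the exponential of the phase function. -/
def twisted (M : Matrix (Fin 3) (Fin 3) ℂ) : Module.End ℂ R :=
  (vf M).toLinearMap.restrictScalars ℂ + LinearMap.mulLeft ℂ (vf M phase)

theorem twisted_apply (M : Matrix (Fin 3) (Fin 3) ℂ) (f : R) :
    twisted M f = vf M f + vf M phase * f := rfl

theorem twisted_add (M N : Matrix (Fin 3) (Fin 3) ℂ) :
    twisted (M + N) = twisted M + twisted N := by
  refine LinearMap.ext fun f => ?_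
  simp only [LinearMap.add_apply, twisted_apply, vf_add, Derivation.add_apply]
  ring

theorem twisted_smul (c : ℂ) (M : Matrix (Fin 3) (Fin 3) ℂ) :
    twisted (c • M) = c • twisted M := by
  refine LinearMap.ext fun f => ?_
  simp only [LinearMap.smul_apply, twisted_apply, vf_smul, smul_add, smul_mul_assoc]

/-- Formally `twisted M` is exp(-phase) ∘ `vf M` ∘ exp(phase), and conjugation preserves
commutators. -/
theorem twisted_lie (M N : Matrix (Fin 3) (Fin 3) ℂ) :
    twisted (M * N - N * M) = twisted M * twisted N - twisted N * twisted M := by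
  refine LinearMap.ext fun f => ?_
  simp only [LinearMap.sub_apply, twisted_apply, vf_lie, Derivation.commutator_apply,
    Module.End.mul_apply, map_add, Derivation.leibniz, smul_eq_mul]
  ring

/-- The action of `sl3` by twisted vector fields. -/
def rep : sl3 →ₗ⁅ℂ⁆ Module.End ℂ R where
  toFun M := twisted M.val
  map_add' _ _ := twisted_add _ _
  map_smul' _ _ := twisted_smul _ _
  map_lie' := twisted_lie _ _

/-- The total symbol of an element of `U`. -/
def symbol : U →ₗ[ℂ] S where
  toFun u := MvPolynomial.constantCoeff (UniversalEnvelopingAlgebra.lift ℂ rep u 1)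
  map_add' u v := by simp
  map_smul' c u := by
    rw [map_smul, LinearMap.smul_apply, RingHom.id_apply, smul_eq_const_mul, const_apply,
      map_mul, MvPolynomial.constantCoeff_C, MvPolynomial.smul_eq_C_mul]

/-- The elements of `R` of degree `< d` in the variables of `S`. -/
def lowDegree (d : ℕ) : Submodule ℂ R :=
  Submodule.span ℂ {x | ∃ (L : List (Fin 8)) (f : MvPolynomial (Fin 3 × Fin 3) ℂ),
    L.length < d ∧ C (L.map X).prod * MvPolynomial.map C f = x}

theorem lowDegree_mono {d d' : ℕ} (h : d ≤ d') : lowDegree d ≤ lowDegree d' := by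
  refine Submodule.span_mono ?_
  rintro _ ⟨L, f, h₁, rfl⟩
  exact ⟨L, f, by omega, rfl⟩

theorem mul_mem_lowDegree {d d' : ℕ} {x y : R} (hx : x ∈ lowDegree (d + 1))
    (hy : y ∈ lowDegree d') : x * y ∈ lowDegree (d + d') := by
  have h : lowDegree (d + 1) * lowDegree d' ≤ lowDegree (d + d') := by
    rw [lowDegree, lowDegree, Submodule.span_mul_span, Submodule.span_le]
    rintro _ ⟨_, ⟨L, f, h₁, rfl⟩, _, ⟨L', f', h₁', rfl⟩, rfl⟩
    refine Submodule.subset_span ⟨L ++ L', f * f', ?_, ?_⟩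
    · simp only [List.length_append]; omega
    · simp only [List.map_append, List.prod_append, map_mul]; ring
  exact h (Submodule.mul_mem_mul hx hy)

theorem exists_map_eq_vf_map (M : Matrix (Fin 3) (Fin 3) ℂ) (f : MvPolynomial (Fin 3 × Fin 3) ℂ) :
    ∃ f', MvPolynomial.map C f' = vf M (MvPolynomial.map C f) := by
  have hX : ∀ i j, ∃ f', MvPolynomial.map C f' = vf M (X (i, j)) := by
    intro i j
    refine ⟨∑ k, ((if i = k then 1 else 0) + X (i, k)) * C (M k j), ?_⟩
    rw [vf_X, Matrix.mul_apply, map_sum]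
    refine Finset.sum_congr rfl fun k _ => ?_
    rw [Matrix.add_apply, Matrix.one_apply, Matrix.map_apply, const_apply]
    split_ifs <;> simp [generic]
  induction f using MvPolynomial.induction_on with
  | C a => exact ⟨0, by rw [MvPolynomial.map_C, MvPolynomial.derivation_C, map_zero]⟩
  | add p q hp hq =>
    obtain ⟨p', hp⟩ := hp
    obtain ⟨q', hq⟩ := hq
    exact ⟨p' + q', by simp [hp, hq]⟩
  | mul_X p i hp =>
    obtain ⟨p', hp⟩ := hp
    obtain ⟨r, hr⟩ := hX i.1 i.2
    exact ⟨p * r + X i * p', by simp [hp, hr]⟩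

theorem vf_mem_lowDegree (M : Matrix (Fin 3) (Fin 3) ℂ) {d : ℕ} {x : R} (hx : x ∈ lowDegree d) :
    vf M x ∈ lowDegree d := by
  induction hx using Submodule.span_induction with
  | mem x h =>
    obtain ⟨L, f, h₁, rfl⟩ := h
    obtain ⟨f', hf'⟩ := exists_map_eq_vf_map M f
    rw [Derivation.leibniz, MvPolynomial.derivation_C, smul_zero, add_zero, smul_eq_mul, ← hf']
    exact Submodule.subset_span ⟨L, f', h₁, rfl⟩
  | zero => simp
  | add x y _ _ hx hy => rw [map_add]; exact add_mem hx hy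
  | smul a x _ hx => rw [Derivation.map_smul_of_tower]; exact Submodule.smul_mem _ _ hx

theorem phase_mem_lowDegree : phase ∈ lowDegree 2 := by
  refine Submodule.sum_mem _ fun k _ => Submodule.subset_span
    ⟨[k], coord (Matrix.of fun i j => X (i, j)) k, by simp, ?_⟩
  rw [← coord_map]
  congr 2
  · simp
  · ext i j : 2
    simp [generic]

theorem prod_phase_mem_lowDegree (L : List (Fin 8)) :
    (L.map fun i => vf (genSl i).val phase).prod ∈ lowDegree (L.length + 1) := by
  induction L with
  | nil => exact Submodule.subset_span ⟨[], 1, by simp, by simp⟩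
  | cons i L ih =>
    rw [List.map_cons, List.prod_cons]
    convert mul_mem_lowDegree (d := 1) (vf_mem_lowDegree (genSl i).val phase_mem_lowDegree) ih
      using 2
    simp; omega

/-- Differentiation does not raise the degree in the variables of `S`; only multiplication by `vf M
phase` does, by one. The top part of a word applied to 1 is thus the product of these factors. -/
theorem lift_rep_prod_sub_mem (L : List (Fin 8)) :
    UniversalEnvelopingAlgebra.lift ℂ rep (L.map gen).prod 1 -
      (L.map fun i => vf (genSl i).val phase).prod ∈ lowDegree L.length := by
  induction L with
  | nil => simp
  | cons i L ih =>
    set r := UniversalEnvelopingAlgebra.lift ℂ rep (L.map gen).prod 1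
    set p := (L.map fun i => vf (genSl i).val phase).prod
    have hp : p ∈ lowDegree (L.length + 1) := prod_phase_mem_lowDegree L
    have hr : r ∈ lowDegree (L.length + 1) := by
      have := add_mem (lowDegree_mono (Nat.le_succ _) ih) hp
      simpa using this
    have h : UniversalEnvelopingAlgebra.lift ℂ rep ((i :: L).map gen).prod 1 =
        vf (genSl i).val r + vf (genSl i).val phase * r := by
      rw [List.map_cons, List.prod_cons, map_mul, gen, toU,
        UniversalEnvelopingAlgebra.lift_ι_apply]
      rfl
    have h' : vf (genSl i).val r + vf (genSl i).val phase * r - vf (genSl i).val phase * p =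
        vf (genSl i).val r + vf (genSl i).val phase * (r - p) := by ring
    rw [h, List.map_cons, List.prod_cons, h', List.length_cons, add_comm L.length]
    refine add_mem ?_ (mul_mem_lowDegree (vf_mem_lowDegree _ phase_mem_lowDegree) ih)
    rw [add_comm]
    exact vf_mem_lowDegree _ hr

/-- At the origin `vf M` is differentiation in the direction M, and the phase is linear with k-th
coordinate weighted by `X k`. -/
theorem constantCoeff_vf_phase (i : Fin 8) :
    MvPolynomial.constantCoeff (vf (genSl i).val phase) = X i := by
  have h : ∀ a b, MvPolynomial.constantCoeff (vf (genSl i).val (generic a b)) =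
      ((genInt i a b : ℤ) : S) := by
    intro a b
    rw [generic, Matrix.of_apply, vf_X, genSl_val]
    simp [Matrix.mul_apply, generic, Matrix.one_apply, add_mul, Finset.sum_add_distrib]
  have h' : ∀ k, MvPolynomial.constantCoeff (vf (genSl i).val (coord generic k)) =
      ((coord (genInt i) k : ℤ) : S) := by
    intro k
    fin_cases k <;> simp [coord, h]
  have h'' : ∀ i k, coord (genInt i) k = if i = k then 1 else 0 := by decide
  simp only [phase, map_sum, Derivation.leibniz, MvPolynomial.derivation_C, smul_eq_mul, map_add,
    map_mul, h', h'']
  simp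

theorem symbol_prod_sub_mem (L : List (Fin 8)) :
    symbol (L.map gen).prod - (L.map X).prod ∈
      lowerSpan (A := S) X (fun _ => 0) L.length 1 := by
  have key : ∀ x ∈ lowDegree L.length, MvPolynomial.constantCoeff x ∈
      lowerSpan (A := S) X (fun _ => 0) L.length 1 := by
    intro x hx
    induction hx using Submodule.span_induction with
    | mem x h =>
      obtain ⟨L', f, h₁, rfl⟩ := h
      rw [map_mul, MvPolynomial.constantCoeff_C, MvPolynomial.constantCoeff_map, mul_comm,
        ← MvPolynomial.smul_eq_C_mul]
      exact Submodule.smul_mem _ _ (prod_mem_lowerSpan _ h₁ (by simp))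
    | zero => simp
    | add x y _ _ hx hy => rw [map_add]; exact add_mem hx hy
    | smul a x _ hx =>
      rw [smul_eq_const_mul, const_apply, map_mul, MvPolynomial.constantCoeff_C,
        ← MvPolynomial.smul_eq_C_mul]
      exact Submodule.smul_mem _ _ hx
  have := key _ (lift_rep_prod_sub_mem L)
  rw [map_sub, map_list_prod MvPolynomial.constantCoeff, List.map_map] at this
  simp only [Function.comp_def, constantCoeff_vf_phase] at this
  exact this

/-! ### The degree filtration and principal symbols -/

/-- The span of the products of fewer than `d` generators of `U`. -/
abbrev filt (d : ℕ) : Submodule ℂ U := lowerSpan gen (fun _ => 0) d 1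

theorem lowerSpan_wt_le_filt (d n : ℕ) : lowerSpan gen wt d n ≤ filt d :=
  lowerSpan_le fun L hL _ => prod_mem_lowerSpan L hL (by simp)

/-- The component of degree `d` of the symbol. -/
def topSym (d : ℕ) : U →ₗ[ℂ] S := MvPolynomial.homogeneousComponent d ∘ₗ symbol

theorem isHomogeneous_prod_X (L : List (Fin 8)) :
    ((L.map X).prod : S).IsHomogeneous L.length := by
  induction L with
  | nil => exact MvPolynomial.isHomogeneous_one _ _
  | cons i L ih =>
    rw [List.map_cons, List.prod_cons, List.length_cons, add_comm]
    exact (MvPolynomial.isHomogeneous_X ℂ i).mul ih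

theorem homogeneousComponent_eq_zero_of_mem_lowerSpan {d n : ℕ} (h : d ≤ n) {p : S}
    (hp : p ∈ lowerSpan (A := S) X (fun _ => 0) d 1) :
    MvPolynomial.homogeneousComponent n p = 0 := by
  refine (lowerSpan_le (P := LinearMap.ker (MvPolynomial.homogeneousComponent n)) ?_) hp
  intro L hL _
  rw [LinearMap.mem_ker, MvPolynomial.homogeneousComponent_of_mem (isHomogeneous_prod_X L),
    if_neg (by omega)]

theorem topSym_prod (L : List (Fin 8)) : topSym L.length (L.map gen).prod = (L.map X).prod := by
  have := homogeneousComponent_eq_zero_of_mem_lowerSpan le_rfl (symbol_prod_sub_mem L)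
  rw [map_sub, sub_eq_zero,
    MvPolynomial.homogeneousComponent_eq_self (isHomogeneous_prod_X L)] at this
  exact this

theorem topSym_eq_zero {d n : ℕ} (h : d ≤ n) {u : U} (hu : u ∈ filt d) : topSym n u = 0 := by
  refine (lowerSpan_le (P := LinearMap.ker (topSym n)) ?_) hu
  intro L hL _
  have h₁ := homogeneousComponent_eq_zero_of_mem_lowerSpan (n := n) (by omega)
    (symbol_prod_sub_mem L)
  rw [map_sub, sub_eq_zero, MvPolynomial.homogeneousComponent_of_mem (isHomogeneous_prod_X L),
    if_neg (by omega)] at h₁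
  exact h₁

theorem topSym_prod_of_le {d : ℕ} (L : List (Fin 8)) (h : L.length ≤ d) :
    topSym d (L.map gen).prod = if L.length = d then (L.map X).prod else 0 := by
  split_ifs with h'
  · rw [← h', topSym_prod]
  · exact topSym_eq_zero le_rfl (prod_mem_lowerSpan L (by omega) (by simp))

theorem isHomogeneous_topSym (d : ℕ) (u : U) : (topSym d u).IsHomogeneous d :=
  MvPolynomial.homogeneousComponent_isHomogeneous d _

theorem mul_mem_filt {d d' : ℕ} {u v : U} (hu : u ∈ filt (d + 1)) (hv : v ∈ filt (d' + 1)) :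
    u * v ∈ filt (d + d' + 1) :=
  mul_mem_lowerSpan hu hv (by omega) le_rfl

theorem topSym_mul {d d' : ℕ} {u v : U} (hu : u ∈ filt (d + 1)) (hv : v ∈ filt (d' + 1)) :
    topSym (d + d') (u * v) = topSym d u * topSym d' v := by
  induction hu, hv using Submodule.span_induction₂ with
  | mem_mem x y hx hy =>
    obtain ⟨L, hL, -, rfl⟩ := hx
    obtain ⟨L', hL', -, rfl⟩ := hy
    have : (L.map gen).prod * (L'.map gen).prod = ((L ++ L').map gen).prod := by simp
    rw [this, topSym_prod_of_le _ (by simp only [List.length_append]; omega),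
      topSym_prod_of_le L (by omega), topSym_prod_of_le L' (by omega)]
    simp only [List.length_append]
    split_ifs <;> first | omega | simp
  | zero_left => simp
  | zero_right => simp
  | add_left x y z _ _ _ h₁ h₂ => simp only [add_mul, map_add, h₁, h₂]
  | add_right x y z _ _ _ h₁ h₂ => simp only [mul_add, map_add, h₁, h₂]
  | smul_left r x y _ _ h => simp only [smul_mul_assoc, map_smul, h]
  | smul_right r x y _ _ h => simp only [mul_smul_comm, map_smul, h]

/-! ### Ordered monomials and the Poincaré–Birkhoff–Witt theorem -/

/-- The ordered word with prescribed multiplicities. -/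
def word (a : Fin 8 →₀ ℕ) : List (Fin 8) :=
  (List.finRange 8).flatMap fun i => List.replicate (a i) i

theorem count_word (a : Fin 8 →₀ ℕ) (i : Fin 8) : (word a).count i = a i := by
  have h : (word a).count i = ∑ j, if j = i then a j else 0 := by
    rw [Fin.sum_univ_eight]
    simp [word, List.count_flatMap, Function.comp_def, List.count_replicate,
      ← List.ofFn_eq_map, add_assoc]
  simp [h]

theorem perm_word (L : List (Fin 8)) : L.Perm (word (Multiset.toFinsupp (L : Multiset (Fin 8)))) :=
  List.perm_iff_count.2 fun i => by simp [count_word]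

theorem map_word_prod {M : Type*} [Monoid M] (f : Fin 8 → M) (a : Fin 8 →₀ ℕ) :
    ((word a).map f).prod = f 0 ^ a 0 * f 1 ^ a 1 * f 2 ^ a 2 * f 3 ^ a 3 * f 4 ^ a 4 *
      f 5 ^ a 5 * f 6 ^ a 6 * f 7 ^ a 7 := by
  simp [word, List.finRange_succ, mul_assoc]

theorem prod_X_word (a : Fin 8 →₀ ℕ) : ((word a).map X).prod = MvPolynomial.monomial a (1 : ℂ) := by
  rw [map_word_prod, MvPolynomial.monomial_eq, Finsupp.prod_fintype _ _ (by simp)]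
  simp [Fin.prod_univ_eight]

theorem length_word (a : Fin 8 →₀ ℕ) : (word a).length = a.degree := by
  rw [Finsupp.degree_eq_sum, Fin.sum_univ_eight]
  simp [word, List.length_flatMap, ← List.ofFn_eq_map, add_assoc]

/-- The ordered monomial of `U` with prescribed multiplicities. -/
def ordProd (a : Fin 8 →₀ ℕ) : U := ((word a).map gen).prod

/-- The linear map `S → U` sending monomials to ordered monomials. -/
def normalOrder : S →ₗ[ℂ] U := (MvPolynomial.basisMonomials (Fin 8) ℂ).constr ℂ ordProd

theorem normalOrder_monomial (a : Fin 8 →₀ ℕ) (c : ℂ) :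
    normalOrder (MvPolynomial.monomial a c) = c • ordProd a := by
  have := (MvPolynomial.basisMonomials (Fin 8) ℂ).constr_basis ℂ ordProd a
  rw [MvPolynomial.coe_basisMonomials] at this
  rw [show MvPolynomial.monomial a c = c • MvPolynomial.monomial a 1 by
    simp [MvPolynomial.smul_monomial], map_smul, normalOrder, this]

theorem prod_sub_prod_mem_of_perm {L L' : List (Fin 8)} (h : L.Perm L') :
    (L.map gen).prod - (L'.map gen).prod ∈ lowerSpan gen wt L.length (L.map wt).sum :=
  prod_sub_prod_mem_lowerSpan_of_perm gen_commutator_mem_lowerSpan h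

/-- Sorting a word costs only shorter words, so an element agrees with the normal ordering of its
symbol up to lower degree. -/
theorem sub_normalOrder_topSym_mem {d : ℕ} {u : U} (hu : u ∈ filt (d + 1)) :
    u - normalOrder (topSym d u) ∈ filt d := by
  refine (lowerSpan_le (P := (filt d).comap (LinearMap.id - normalOrder ∘ₗ topSym d)) ?_) hu
  intro L hL _
  rw [Submodule.mem_comap, LinearMap.sub_apply, LinearMap.id_apply, LinearMap.comp_apply,
    topSym_prod_of_le L (by omega)]
  split_ifs with h
  · rw [((perm_word L).map X).prod_eq, prod_X_word, normalOrder_monomial, one_smul, ← h]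
    exact lowerSpan_wt_le_filt _ _ (prod_sub_prod_mem_of_perm (perm_word L))
  · rw [map_zero, sub_zero]
    exact prod_mem_lowerSpan L (by omega) (by simp)

theorem mem_filt_of_topSym_eq_zero {d : ℕ} {u : U} (hu : u ∈ filt (d + 1)) (h : topSym d u = 0) :
    u ∈ filt d := by
  simpa [h] using sub_normalOrder_topSym_mem hu

theorem topSym_normalOrder {d : ℕ} {p : S} (hp : p.totalDegree ≤ d) :
    topSym d (normalOrder p) = MvPolynomial.homogeneousComponent d p := by
  rw [p.as_sum, map_sum, map_sum, map_sum]
  refine Finset.sum_congr rfl fun a ha => ?_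
  have h : a.degree ≤ d := (MvPolynomial.le_totalDegree ha).trans hp
  rw [normalOrder_monomial, map_smul, ordProd, topSym_prod_of_le _ (by rwa [length_word]),
    length_word, prod_X_word,
    MvPolynomial.homogeneousComponent_of_mem (MvPolynomial.isHomogeneous_monomial _ rfl)]
  simp only [eq_comm (a := d)]
  split_ifs <;> simp [MvPolynomial.smul_monomial]

/-- The top homogeneous component of `p` is recovered as the symbol of `normalOrder p`, and it is
nonzero when `p` is. -/
theorem normalOrder_injective : Function.Injective normalOrder := by
  refine (injective_iff_map_eq_zero _).2 fun p hp => ?_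
  by_contra h
  have h₁ := topSym_normalOrder (p := p) le_rfl
  rw [hp, map_zero] at h₁
  obtain ⟨a, ha, hd⟩ := Finset.exists_mem_eq_sup p.support
    (Finset.nonempty_iff_ne_empty.2 fun h' => h (MvPolynomial.support_eq_empty.1 h'))
    fun a => a.degree
  have hd' : a.degree = p.totalDegree := hd.symm
  have h₂ := congrArg (MvPolynomial.coeff a) h₁
  rw [MvPolynomial.coeff_homogeneousComponent, if_pos hd'] at h₂
  exact MvPolynomial.mem_support_iff.1 ha h₂.symm

/-- Ordered monomials are linearly independent. -/
theorem linearIndependent_ordProd : LinearIndependent ℂ ordProd := by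
  have h : normalOrder ∘ MvPolynomial.basisMonomials (Fin 8) ℂ = ordProd := by
    ext a
    simp [normalOrder_monomial]
  rw [← h]
  exact (MvPolynomial.basisMonomials (Fin 8) ℂ).linearIndependent.map' normalOrder
    (LinearMap.ker_eq_bot.2 normalOrder_injective)

theorem adjoin_range_toU : Algebra.adjoin ℂ (Set.range toU) = ⊤ := by
  have h : Set.range toU = UniversalEnvelopingAlgebra.mkAlgHom ℂ sl3 ''
      Set.range (TensorAlgebra.ι ℂ (M := sl3)) := by
    rw [← Set.range_comp]
    rfl
  rw [h, ← AlgHom.map_adjoin, TensorAlgebra.adjoin_range_ι, Algebra.map_top,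
    AlgHom.range_eq_top]
  exact RingCon.mk'_surjective _

theorem exists_mem_filt (u : U) : ∃ d, u ∈ filt (d + 1) := by
  have hu : u ∈ Algebra.adjoin ℂ (Set.range toU) := adjoin_range_toU ▸ Algebra.mem_top
  induction hu using Algebra.adjoin_induction with
  | mem x hx =>
    obtain ⟨M, rfl⟩ := hx
    refine ⟨1, ?_⟩
    rw [toU_eq_sum]
    refine Submodule.sum_mem _ fun k _ => Submodule.smul_mem _ _ ?_
    simpa using prod_mem_lowerSpan (g := gen) (w := fun _ => 0) (d := 2) (n := 1) [k]
  | algebraMap c =>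
    refine ⟨0, ?_⟩
    rw [Algebra.algebraMap_eq_smul_one]
    refine Submodule.smul_mem _ _ ?_
    simpa using prod_mem_lowerSpan (g := gen) (w := fun _ => 0) (d := 1) (n := 1) []
  | add x y _ _ hx hy =>
    obtain ⟨d, hx⟩ := hx
    obtain ⟨d', hy⟩ := hy
    exact ⟨d + d', add_mem (lowerSpan_mono (by omega) le_rfl hx)
      (lowerSpan_mono (by omega) le_rfl hy)⟩
  | mul x y _ _ hx hy =>
    obtain ⟨d, hx⟩ := hx
    obtain ⟨d', hy⟩ := hy
    exact ⟨d + d', mul_mem_filt hx hy⟩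

/-! ### The Casimir elements -/

/-- The trace-zero part of the matrix unit `E_{ij}`. -/
def unitSl (i j : Fin 3) : sl3 :=
  ⟨Matrix.single i j 1 - (if i = j then 1 / 3 else 0 : ℂ) • 1, by
    change Matrix.trace (_ : Matrix (Fin 3) (Fin 3) ℂ) = 0
    rw [Matrix.trace_sub, Matrix.trace_smul, Matrix.trace_one]
    split_ifs with h
    · subst h; simp
    · simp [Matrix.trace_single_eq_of_ne i j _ h]⟩

theorem unitSl_lie (a b c d : Fin 3) :
    ⁅unitSl a b, unitSl c d⁆ =
      (if b = c then unitSl a d else 0) - (if a = d then unitSl c b else 0) := by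
  apply Subtype.ext
  rw [LieAlgebra.SpecialLinear.sl_bracket]
  have h : ∀ (M N : Matrix (Fin 3) (Fin 3) ℂ) (s t : ℂ),
      (M - s • 1) * (N - t • 1) - (N - t • 1) * (M - s • 1) = M * N - N * M := by
    intro M N s t
    simp only [mul_sub, sub_mul, Matrix.mul_smul, Matrix.smul_mul, mul_one, one_mul]
    rw [smul_comm s t]
    abel
  simp only [unitSl, h]
  rcases eq_or_ne b c with rfl | hbc <;> rcases eq_or_ne a d with rfl | had
  · simp only [Matrix.single_mul_single_same, if_true]
    simp
  · rw [Matrix.single_mul_single_same, Matrix.single_mul_single_of_ne _ _ _ _ had.symm]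
    simp [had]
  · rw [Matrix.single_mul_single_same, Matrix.single_mul_single_of_ne _ _ _ _ hbc]
    simp [hbc, hbc.symm]
  · rw [Matrix.single_mul_single_of_ne _ _ _ _ had.symm, Matrix.single_mul_single_of_ne _ _ _ _ hbc]
    simp [hbc, had]

theorem eq_sum_unitSl (M : sl3) : M = ∑ i, ∑ j, M.val i j • unitSl i j := by
  have h : M.val 0 0 + M.val 1 1 + M.val 2 2 = 0 := by
    have := M.2
    simpa [sl3, LieAlgebra.SpecialLinear.sl, Matrix.trace, Fin.sum_univ_three] using this
  have h' : M.val 2 2 = -(M.val 0 0 + M.val 1 1) := by linear_combination h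
  ext a b
  simp only [Fin.sum_univ_three]
  fin_cases a <;> fin_cases b <;>
    simp [unitSl, Matrix.single, h'] <;> ring

/-- The matrix over `U` whose entries are the trace-zero parts of the matrix units. -/
def unitMat : Matrix (Fin 3) (Fin 3) U := Matrix.of fun i j => toU (unitSl i j)

theorem unitMat_apply (i j : Fin 3) : unitMat i j = toU (unitSl i j) := rfl

/-- Matrices over `U` whose entries transform under `sl3` like the matrix units. -/
def IsEquivariant (A : Matrix (Fin 3) (Fin 3) U) : Prop :=
  ∀ a b c d, unitMat a b * A c d - A c d * unitMat a b =
    (if b = c then A a d else 0) - (if a = d then A c b else 0)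

theorem isEquivariant_unitMat : IsEquivariant unitMat := by
  intro a b c d
  have h : unitMat a b * unitMat c d - unitMat c d * unitMat a b =
      toU ⁅unitSl a b, unitSl c d⁆ := by
    rw [toU, LieHom.map_lie]; rfl
  rw [h, unitSl_lie, toU, map_sub]
  split_ifs <;> simp [unitMat]

/-- By the Leibniz rule for commutators; the two inner terms, both equal to `A c b * B a d` after
summation over k, cancel. -/
theorem IsEquivariant.mul {A B : Matrix (Fin 3) (Fin 3) U} (hA : IsEquivariant A)
    (hB : IsEquivariant B) : IsEquivariant (A * B) := by
  intro a b c d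
  have h : ∀ k, unitMat a b * (A c k * B k d) - A c k * B k d * unitMat a b =
      (if b = c then A a k * B k d else 0) - (if a = k then A c b * B k d else 0) +
      ((if b = k then A c k * B a d else 0) - (if a = d then A c k * B k b else 0)) := by
    intro k
    have h₁ := congrArg (· * B k d) (hA a b c k)
    have h₂ := congrArg (A c k * ·) (hB a b k d)
    simp only [sub_mul, mul_sub, ite_mul, mul_ite, zero_mul, mul_zero, mul_assoc] at h₁ h₂ ⊢
    rw [← h₁, ← h₂]
    abel
  simp only [Matrix.mul_apply, Finset.mul_sum, Finset.sum_mul, ← Finset.sum_sub_distrib, h,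
    Finset.sum_add_distrib]
  simp only [Finset.sum_sub_distrib, Finset.sum_ite_eq, Finset.mem_univ, if_true]
  split_ifs <;> simp <;> abel

/-- Summing the relation over c = d gives `A a b - A a b = 0`, and the entries of `unitMat` generate
U. -/
theorem IsEquivariant.trace_mem_center {A : Matrix (Fin 3) (Fin 3) U} (hA : IsEquivariant A) :
    A.trace ∈ Z := by
  have h : ∀ a b, unitMat a b * A.trace = A.trace * unitMat a b := by
    intro a b
    rw [← sub_eq_zero]
    simp only [Matrix.trace, Matrix.diag_apply, Finset.mul_sum, Finset.sum_mul,
      ← Finset.sum_sub_distrib, hA a b]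
    simp [Finset.sum_sub_distrib]
  have h' : ∀ M : sl3, toU M * A.trace = A.trace * toU M := by
    intro M
    have : toU M = ∑ i, ∑ j, M.val i j • unitMat i j := by
      conv_lhs => rw [eq_sum_unitSl M]
      simp [toU, unitMat]
    rw [this]
    simp only [Finset.sum_mul, Finset.mul_sum, smul_mul_assoc, mul_smul_comm, h]
  rw [Subalgebra.mem_center_iff]
  intro u
  have hu : u ∈ Algebra.adjoin ℂ (Set.range toU) := adjoin_range_toU ▸ Algebra.mem_top
  induction hu using Algebra.adjoin_induction with
  | mem x hx => obtain ⟨M, rfl⟩ := hx; exact h' M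
  | algebraMap c => exact Algebra.commutes c _
  | add x y _ _ hx hy => rw [add_mul, mul_add, hx, hy]
  | mul x y _ _ hx hy => rw [mul_assoc, hy, ← mul_assoc, hx, mul_assoc]

/-- The quadratic Casimir element. -/
def casimir₂ : U := (unitMat * unitMat).trace

/-- The cubic Casimir element. -/
def casimir₃ : U := (unitMat * unitMat * unitMat).trace

theorem casimir₂_mem_center : casimir₂ ∈ Z :=
  (isEquivariant_unitMat.mul isEquivariant_unitMat).trace_mem_center

theorem casimir₃_mem_center : casimir₃ ∈ Z :=
  ((isEquivariant_unitMat.mul isEquivariant_unitMat).mul isEquivariant_unitMat).trace_mem_center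

/-! ### Leading terms of the Casimir elements -/

theorem unitMat_mem_lowerSpan (i j : Fin 3) :
    unitMat i j ∈ lowerSpan gen wt 2 (!![5, 4, 4; 4, 5, 6; 4, 6, 5] i j) := by
  rw [unitMat_apply, toU_eq_sum]
  refine Submodule.sum_mem _ fun k _ => ?_
  have key : coord (unitSl i j).val k ≠ 0 →
      wt k < (!![5, 4, 4; 4, 5, 6; 4, 6, 5] : Matrix (Fin 3) (Fin 3) ℕ) i j := by
    fin_cases i <;> fin_cases j <;> fin_cases k <;> simp [coord, unitSl, Matrix.single, wt]
  by_cases h : coord (unitSl i j).val k = 0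
  · simp [h]
  · refine Submodule.smul_mem _ _ ?_
    simpa using prod_mem_lowerSpan (g := gen) (w := wt) (d := 2) [k] (by simp)
      (by simpa using key h)

theorem unitMat_trace : unitMat 0 0 + unitMat 1 1 + unitMat 2 2 = 0 := by
  have h : unitSl 0 0 + unitSl 1 1 + unitSl 2 2 = 0 := by
    ext i j
    fin_cases i <;> fin_cases j <;> simp [unitSl, Matrix.single] <;> norm_num
  simp only [unitMat_apply, toU, ← map_add, h, map_zero]

theorem unitMat_gen : unitMat 1 2 = gen 4 ∧ unitMat 2 1 = gen 1 ∧
    unitMat 0 0 - unitMat 1 1 = gen 6 ∧ unitMat 1 1 - unitMat 2 2 = gen 7 := by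
  simp only [unitMat_apply, toU, ← map_sub, gen]
  refine ⟨?_, ?_, ?_, ?_⟩ <;> congr 1 <;> ext i j <;> fin_cases i <;> fin_cases j <;>
    simp [unitSl, genSl, Matrix.single] <;> norm_num

/-- Here a, b, c are the diagonal entries of `unitMat` and x, y its entries 1 2 and 2 1. The left
side gathers the terms of the corrected cubic element in these alone, minus H₂³/9. Since b + c = -a,
the terms of type 3(b + c)xy cancel against 3axy. On the right everything has weight below 12: yx
has weight 10, and a - b is H₁, of weight 3 only, times quadratic terms of weight at most 8. -/
theorem cubic_identity {A : Type*} [Ring A] [Algebra ℂ A] {a b c x y : A} (hsum : a + b + c = 0)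
    (hxy : x * y - y * x = b - c) (hab : a * b - b * a = 0) (hax : a * x - x * a = 0)
    (hay : a * y - y * a = 0) (hbx : b * x - x * b = x) (hby : b * y - y * b = -y) :
    a * a * a + b * b * b + c * c * c + (b * x * y + x * y * b + y * b * x + c * y * x + y * x * c +
      x * c * y) + (3 / 2 : ℂ) • (a * (a * a + b * b + c * c + x * y + y * x)) -
      (1 / 9 : ℂ) • ((b - c) * (b - c) * (b - c)) =
    (2 : ℂ) • (y * x) + ((2 : ℂ) • b + c + 1) * (b - c) + (3 / 2 : ℂ) • (a * (b - c)) +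
      (2 / 9 : ℂ) • ((a - b) * ((13 : ℂ) • (a * a) + (10 : ℂ) • (a * b) + (4 : ℂ) • (b * b))) := by
  obtain rfl : c = -a - b := by rw [← sub_eq_zero, ← hsum]; abel
  have hxy : x * y = y * x + a + (2 : ℂ) • b := by rw [sub_eq_iff_eq_add.1 hxy, two_smul]; abel
  have hba : b * a = a * b := (sub_eq_zero.1 hab).symm
  have hxa : x * a = a * x := (sub_eq_zero.1 hax).symm
  have hya : y * a = a * y := (sub_eq_zero.1 hay).symm
  have hxb : x * b = b * x - x := by rw [sub_eq_iff_eq_add.1 hbx]; abel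
  have hyb : y * b = b * y + y := by rw [sub_eq_iff_eq_add.1 hby]; abel
  have hba' : ∀ z, b * (a * z) = a * b * z := fun z => by rw [← hba, mul_assoc]
  have hya' : ∀ z, y * (a * z) = a * y * z := fun z => by rw [← hya, mul_assoc]
  have hyb' : ∀ z, y * (b * z) = (b * y + y) * z := fun z => by rw [← hyb, mul_assoc]
  simp only [mul_add, add_mul, mul_sub, sub_mul, mul_assoc, smul_mul_assoc, mul_smul_comm, mul_neg,
    neg_mul, hxy, hba, hxa, hxb, hyb, hba', hya', hyb', smul_add, smul_sub,
    one_mul]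
  module

theorem unitMat_commutator (a b c d : Fin 3) :
    unitMat a b * unitMat c d - unitMat c d * unitMat a b =
      (if b = c then unitMat a d else 0) - (if a = d then unitMat c b else 0) :=
  isEquivariant_unitMat a b c d

/-- The bounds on the weights of the entries of `unitMat`. -/
abbrev wtBound (i j : Fin 3) : ℕ := (!![5, 4, 4; 4, 5, 6; 4, 6, 5] : Matrix (Fin 3) (Fin 3) ℕ) i j

theorem unitMat_mul_mem {d n : ℕ} (i j k l : Fin 3) (hd : 3 ≤ d)
    (h : wtBound i j + wtBound k l ≤ n + 1) :
    unitMat i j * unitMat k l ∈ lowerSpan gen wt d n :=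
  lowerSpan_mono hd le_rfl
    (mul_mem_lowerSpan (unitMat_mem_lowerSpan i j) (unitMat_mem_lowerSpan k l) (by omega) h)

theorem unitMat_mul_mul_mem {n : ℕ} (i j k l p q : Fin 3)
    (h : wtBound i j + wtBound k l + wtBound p q ≤ n + 2) :
    unitMat i j * unitMat k l * unitMat p q ∈ lowerSpan gen wt 4 n :=
  mul_mem_lowerSpan (unitMat_mul_mem (n := wtBound i j + wtBound k l - 1) i j k l le_rfl (by omega))
    (unitMat_mem_lowerSpan p q) (by omega) (by
      change _ + wtBound p q ≤ _
      -- Positivity makes the truncated subtraction in the chosen `n` exact.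
      have : 0 < wtBound i j := by fin_cases i <;> fin_cases j <;> simp [wtBound]
      omega)

theorem casimir₂_sub_mem :
    casimir₂ - (2 : ℂ) • (gen 1 * gen 4) ∈ lowerSpan gen wt 3 10 := by
  have h := unitMat_commutator 1 2 2 1
  simp only [if_true] at h
  have h' : casimir₂ - (2 : ℂ) • (gen 1 * gen 4) =
      unitMat 0 0 * unitMat 0 0 + unitMat 0 1 * unitMat 1 0 + unitMat 0 2 * unitMat 2 0 +
      unitMat 1 0 * unitMat 0 1 + unitMat 1 1 * unitMat 1 1 + unitMat 2 0 * unitMat 0 2 +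
      unitMat 2 2 * unitMat 2 2 + (unitMat 1 1 - unitMat 2 2) := by
    rw [← h, ← unitMat_gen.1, ← unitMat_gen.2.1]
    simp only [casimir₂, Matrix.trace, Matrix.diag_apply, Matrix.mul_apply, Fin.sum_univ_three]
    module
  rw [h']
  have hm : ∀ i, unitMat i i ∈ lowerSpan gen wt 3 10 := fun i =>
    lowerSpan_mono (by omega) (by fin_cases i <;> simp) (unitMat_mem_lowerSpan i i)
  refine add_mem (add_mem (add_mem (add_mem (add_mem (add_mem (add_mem ?_ ?_) ?_) ?_) ?_) ?_) ?_)
    (sub_mem (hm 1) (hm 2)) <;> exact unitMat_mul_mem _ _ _ _ le_rfl (by decide)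

theorem casimir₃_add_sub_mem :
    casimir₃ + (3 / 2 : ℂ) • (unitMat 0 0 * casimir₂) - (1 / 9 : ℂ) • (gen 7 * gen 7 * gen 7) ∈
      lowerSpan gen wt 4 12 := by
  have h := cubic_identity unitMat_trace (unitMat_commutator 1 2 2 1)
    (by simpa using unitMat_commutator 0 0 1 1) (by simpa using unitMat_commutator 0 0 1 2)
    (by simpa using unitMat_commutator 0 0 2 1) (by simpa using unitMat_commutator 1 1 1 2)
    (by simpa using unitMat_commutator 1 1 2 1)
  have h' : casimir₃ + (3 / 2 : ℂ) • (unitMat 0 0 * casimir₂) -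
        (1 / 9 : ℂ) • (gen 7 * gen 7 * gen 7) =
      (unitMat 0 0 * unitMat 0 1 * unitMat 1 0 + unitMat 0 0 * unitMat 0 2 * unitMat 2 0 +
      unitMat 0 1 * unitMat 1 0 * unitMat 0 0 + unitMat 0 1 * unitMat 1 1 * unitMat 1 0 +
      unitMat 0 1 * unitMat 1 2 * unitMat 2 0 + unitMat 0 2 * unitMat 2 0 * unitMat 0 0 +
      unitMat 0 2 * unitMat 2 1 * unitMat 1 0 + unitMat 0 2 * unitMat 2 2 * unitMat 2 0 +
      unitMat 1 0 * unitMat 0 0 * unitMat 0 1 + unitMat 1 0 * unitMat 0 1 * unitMat 1 1 +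
      unitMat 1 0 * unitMat 0 2 * unitMat 2 1 + unitMat 1 1 * unitMat 1 0 * unitMat 0 1 +
      unitMat 1 2 * unitMat 2 0 * unitMat 0 1 + unitMat 2 0 * unitMat 0 0 * unitMat 0 2 +
      unitMat 2 0 * unitMat 0 1 * unitMat 1 2 + unitMat 2 0 * unitMat 0 2 * unitMat 2 2 +
      unitMat 2 1 * unitMat 1 0 * unitMat 0 2 + unitMat 2 2 * unitMat 2 0 * unitMat 0 2 +
      (3 / 2 : ℂ) • (unitMat 0 0 * unitMat 0 1 * unitMat 1 0 +
        unitMat 0 0 * unitMat 0 2 * unitMat 2 0 + unitMat 0 0 * unitMat 1 0 * unitMat 0 1 +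
        unitMat 0 0 * unitMat 2 0 * unitMat 0 2)) +
      ((2 : ℂ) • (unitMat 2 1 * unitMat 1 2) +
        ((2 : ℂ) • unitMat 1 1 + unitMat 2 2 + 1) * gen 7 +
        (3 / 2 : ℂ) • (unitMat 0 0 * gen 7) +
        (2 / 9 : ℂ) • (gen 6 * ((13 : ℂ) • (unitMat 0 0 * unitMat 0 0) +
          (10 : ℂ) • (unitMat 0 0 * unitMat 1 1) + (4 : ℂ) • (unitMat 1 1 * unitMat 1 1)))) := by
    rw [← unitMat_gen.2.2.1, ← unitMat_gen.2.2.2, ← h]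
    simp only [casimir₂, casimir₃, Matrix.trace, Matrix.diag_apply, Matrix.mul_apply,
      Fin.sum_univ_three, mul_add, mul_assoc]
    module
  rw [h']
  have hgen : ∀ i, gen i ∈ lowerSpan gen wt 2 (wt i + 1) := fun i => by
    simpa using prod_mem_lowerSpan (g := gen) (w := wt) (d := 2) (n := wt i + 1) [i]
      (by simp) (by simp)
  have hone : (1 : U) ∈ lowerSpan gen wt 2 5 := by
    simpa using prod_mem_lowerSpan (g := gen) (w := wt) (d := 2) (n := 5) [] (by simp) (by simp)
  have h00 : unitMat 0 0 ∈ lowerSpan gen wt 2 5 := unitMat_mem_lowerSpan 0 0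
  have h11 : unitMat 1 1 ∈ lowerSpan gen wt 2 5 := unitMat_mem_lowerSpan 1 1
  have h22 : unitMat 2 2 ∈ lowerSpan gen wt 2 5 := unitMat_mem_lowerSpan 2 2
  have hq : ∀ i j, unitMat i i * unitMat j j ∈ lowerSpan gen wt 3 9 := fun i j =>
    unitMat_mul_mem _ _ _ _ le_rfl (by fin_cases i <;> fin_cases j <;> decide)
  refine add_mem (add_mem ?_ (Submodule.smul_mem _ _ ?_)) (add_mem (add_mem (add_mem
    (Submodule.smul_mem _ _ (unitMat_mul_mem _ _ _ _ (by omega) (by decide))) ?_)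
    (Submodule.smul_mem _ _ ?_)) (Submodule.smul_mem _ _ ?_))
  · refine add_mem (add_mem (add_mem (add_mem (add_mem (add_mem (add_mem (add_mem (add_mem
      (add_mem (add_mem (add_mem (add_mem (add_mem (add_mem (add_mem (add_mem
      ?_ ?_) ?_) ?_) ?_) ?_) ?_) ?_) ?_) ?_) ?_) ?_) ?_) ?_) ?_) ?_) ?_) ?_ <;>
    exact unitMat_mul_mul_mem _ _ _ _ _ _ (by decide)
  · refine add_mem (add_mem (add_mem ?_ ?_) ?_) ?_ <;>
    exact unitMat_mul_mul_mem _ _ _ _ _ _ (by decide)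
  · exact mul_mem_lowerSpan (add_mem (add_mem (Submodule.smul_mem _ _ h11) h22) hone) (hgen 7)
      (by omega) (by decide)
  · exact mul_mem_lowerSpan h00 (hgen 7) (by omega) (by decide)
  · exact mul_mem_lowerSpan (hgen 6) (add_mem (add_mem (Submodule.smul_mem _ _ (hq 0 0))
      (Submodule.smul_mem _ _ (hq 0 1))) (Submodule.smul_mem _ _ (hq 1 1))) (by omega) (by decide)

/-! ### The basis over ℂ -/

namespace Exponents

/-- The total degree. -/
def degree (e : Exponents) : ℕ := e.j₁ + e.j₂ + e.j₃ + e.l₁ + e.l₂ + e.l₃ + e.r₁ + e.r₂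

/-- The exponents of the leading monomial of `casimir₂ ^ i * casimir₃ ^ k * monomial e`. -/
def leading (i k : ℕ) (e : Exponents) : Fin 8 →₀ ℕ :=
  Finsupp.equivFunOnFinite.symm
    ![e.j₁, e.j₂ + i, e.j₃, e.l₁, e.l₂ + i, e.l₃, e.r₁, e.r₂ + 3 * k]

theorem leading_apply (i k : ℕ) (e : Exponents) (m : Fin 8) : leading i k e m =
    ![e.j₁, e.j₂ + i, e.j₃, e.l₁, e.l₂ + i, e.l₃, e.r₁, e.r₂ + 3 * k] m := rfl

/-- Since j₂l₂ = 0, i is the minimum of the exponents of Y₂ and X₂; since r₂ ≤ 2, k and r₂ are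
quotient and remainder of the exponent of H₂ by 3. -/
theorem leading_injective :
    Function.Injective fun t : ℕ × ℕ × Exponents => leading t.1 t.2.1 t.2.2 := by
  rintro ⟨i, k, e⟩ ⟨i', k', e'⟩ h
  have h' : ∀ m, leading i k e m = leading i' k' e' m := fun m => DFunLike.congr_fun h m
  simp only [leading_apply, Fin.forall_fin_succ] at h'
  simp at h'
  obtain ⟨h0, h1, h2, h3, h4, h5, h6, h7⟩ := h'
  have hr := e.r₂_le
  have hr' := e'.r₂_le
  have hi : i = i' := by
    rcases Nat.mul_eq_zero.1 e.j₂_mul_l₂ with h | h <;>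
    rcases Nat.mul_eq_zero.1 e'.j₂_mul_l₂ with h' | h' <;> omega
  have hk : k = k' := by omega
  subst hi hk
  simp only [Prod.mk.injEq, true_and]
  ext <;> omega

theorem degree_leading (i k : ℕ) (e : Exponents) :
    (leading i k e).degree = 2 * i + 3 * k + e.degree := by
  rw [Finsupp.degree_eq_sum, Fin.sum_univ_eight]
  simp [leading_apply, degree]
  ring

end Exponents

theorem monomial_eq_ordProd (e : Exponents) : monomial e = ordProd (e.leading 0 0) := by
  rw [ordProd, map_word_prod]
  rfl

/-- Products of central elements and the distinguished monomials. -/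
def centralMul (t : ℕ × ℕ × Exponents) : U := casimir₂ ^ t.1 * casimir₃ ^ t.2.1 * monomial t.2.2

/-- The degree of `centralMul`. -/
def centralDeg (t : ℕ × ℕ × Exponents) : ℕ := 2 * t.1 + 3 * t.2.1 + t.2.2.degree

/-- The span of the elements `centralMul` of bounded degree. -/
def centralSpan (d : ℕ) : Submodule ℂ U := Submodule.span ℂ (centralMul '' {t | centralDeg t ≤ d})

theorem centralSpan_mono {d d' : ℕ} (h : d ≤ d') : centralSpan d ≤ centralSpan d' :=
  Submodule.span_mono (Set.image_mono fun _ ht => le_trans ht h)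

theorem casimir₂_mul_mem {d : ℕ} {u : U} (hu : u ∈ centralSpan d) :
    casimir₂ * u ∈ centralSpan (d + 2) := by
  induction hu using Submodule.span_induction with
  | mem x hx =>
    obtain ⟨⟨i, k, e⟩, ht, rfl⟩ := hx
    refine Submodule.subset_span ⟨(i + 1, k, e), ?_, ?_⟩
    · simp only [centralDeg, Set.mem_ofPred_eq] at ht ⊢; omega
    · simp only [centralMul, pow_succ', mul_assoc]
  | zero => simp
  | add x y _ _ hx hy => rw [mul_add]; exact add_mem hx hy
  | smul c x _ hx => rw [mul_smul_comm]; exact Submodule.smul_mem _ _ hx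

theorem casimir₃_mul_mem {d : ℕ} {u : U} (hu : u ∈ centralSpan d) :
    casimir₃ * u ∈ centralSpan (d + 3) := by
  induction hu using Submodule.span_induction with
  | mem x hx =>
    obtain ⟨⟨i, k, e⟩, ht, rfl⟩ := hx
    refine Submodule.subset_span ⟨(i, k + 1, e), ?_, ?_⟩
    · simp only [centralDeg, Set.mem_ofPred_eq] at ht ⊢; omega
    · have h := Subalgebra.mem_center_iff.1 (pow_mem casimir₂_mem_center i) casimir₃
      simp only [centralMul, pow_succ', ← mul_assoc, h]
  | zero => simp
  | add x y _ _ hx hy => rw [mul_add]; exact add_mem hx hy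
  | smul c x _ hx => rw [mul_smul_comm]; exact Submodule.smul_mem _ _ hx

theorem exists_leading_zero_eq {a : Fin 8 →₀ ℕ} (h : a 1 = 0 ∨ a 4 = 0) (h' : a 7 < 3) :
    ∃ e : Exponents, e.leading 0 0 = a := by
  refine ⟨⟨a 0, a 1, a 2, a 3, a 4, a 5, a 6, a 7, Nat.mul_eq_zero.2 h, by omega⟩, ?_⟩
  ext m
  fin_cases m <;> simp [Exponents.leading_apply]

theorem prod_mem_centralSpan (L : List (Fin 8)) : (L.map gen).prod ∈ centralSpan L.length := by
  induction hn : (L.map wt).sum using Nat.strong_induction_on generalizing L with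
  | _ n ih =>
  have hlow : ∀ d, lowerSpan gen wt (d + 1) (L.map wt).sum ≤ centralSpan d := fun d =>
    lowerSpan_le fun L' hd hw =>
      centralSpan_mono (by omega) (ih _ (by omega) L' rfl)
  have hperm : ∀ L' : List (Fin 8), L.Perm L' → (L'.map gen).prod ∈ centralSpan L.length →
      (L.map gen).prod ∈ centralSpan L.length := fun L' hL hL' => by
    have := add_mem (hlow _ (lowerSpan_mono (Nat.le_succ _) le_rfl (prod_sub_prod_mem_of_perm hL)))
      hL'
    rwa [sub_add_cancel] at this
  -- A factor Y₂X₂ is traded for half of `casimir₂`, up to lighter words.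
  by_cases h₁ : 1 ∈ L ∧ 4 ∈ L
  · have hL := (List.perm_cons_erase h₁.1).trans
      ((List.perm_cons_erase ((List.mem_erase_of_ne (a := 4) (b := 1) (by decide)).2 h₁.2)).cons 1)
    set L' := (L.erase 1).erase 4
    have hlen : L.length = L'.length + 2 := hL.length_eq
    have hwt : (L.map wt).sum = 10 + (L'.map wt).sum := by
      rw [(hL.map wt).sum_eq]
      simp [wt]; omega
    refine hperm _ hL ?_
    have h₂ := hlow _ (mul_prod_mem_lowerSpan (d' := L.length + 1) L' casimir₂_sub_mem
      (by omega) (by omega))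
    have h₃ := casimir₂_mul_mem (ih _ (by omega) L' rfl)
    rw [← hlen] at h₃
    have h₄ : ((1 :: 4 :: L').map gen).prod = (1 / 2 : ℂ) • (casimir₂ * (L'.map gen).prod -
        (casimir₂ - (2 : ℂ) • (gen 1 * gen 4)) * (L'.map gen).prod) := by
      simp only [List.map_cons, List.prod_cons, sub_mul, smul_mul_assoc, mul_assoc]
      module
    rw [h₄]
    exact Submodule.smul_mem _ _ (sub_mem h₃ h₂)
  -- A factor H₂³ is traded for 9 times the corrected cubic element. If neither case applies,
  -- sorting the word gives an admissible monomial.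
  by_cases h₂ : 3 ≤ L.count 7
  · obtain ⟨L', hL⟩ := (List.replicate_sublist_iff.2 h₂).exists_perm_append
    have hlen : L.length = L'.length + 3 := by
      rw [hL.length_eq, List.length_append, List.length_replicate, add_comm]
    have hwt : (L.map wt).sum = 12 + (L'.map wt).sum := by
      rw [(hL.map wt).sum_eq]
      simp [wt, List.replicate_succ]; omega
    refine hperm _ hL ?_
    have h₃ := hlow _ (mul_prod_mem_lowerSpan (d' := L.length + 1) L' casimir₃_add_sub_mem
      (by omega) (by omega))
    have h₄ := casimir₃_mul_mem (ih _ (by omega) L' rfl)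
    have h₅ := casimir₂_mul_mem (hlow (L'.length + 1) (mul_prod_mem_lowerSpan L'
      (unitMat_mem_lowerSpan 0 0) (by omega) (by
        change _ + 5 ≤ _
        omega)))
    rw [← hlen] at h₄
    rw [add_assoc, show 1 + 2 = 3 from rfl, ← hlen] at h₅
    have h₆ := Subalgebra.mem_center_iff.1 casimir₂_mem_center (unitMat 0 0)
    have h₇ : ((List.replicate 3 7 ++ L').map gen).prod = (9 : ℂ) • (casimir₃ * (L'.map gen).prod +
        (3 / 2 : ℂ) • (casimir₂ * (unitMat 0 0 * (L'.map gen).prod)) -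
        (casimir₃ + (3 / 2 : ℂ) • (unitMat 0 0 * casimir₂) -
          (1 / 9 : ℂ) • (gen 7 * gen 7 * gen 7)) * (L'.map gen).prod) := by
      rw [h₆]
      simp only [List.map_append, List.map_replicate, List.prod_append, List.prod_replicate,
        sub_mul, add_mul, smul_mul_assoc, mul_assoc, pow_succ, pow_zero, one_mul]
      module
    rw [h₇]
    exact Submodule.smul_mem _ _ (sub_mem (add_mem h₄ (Submodule.smul_mem _ _ h₅)) h₃)
  · obtain ⟨e, he⟩ := exists_leading_zero_eq (a := Multiset.toFinsupp (L : Multiset (Fin 8)))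
      (by
        simp only [Multiset.toFinsupp_apply, Multiset.coe_count, List.count_eq_zero]
        tauto)
      (by simpa using h₂)
    have hL := perm_word L
    rw [← he] at hL
    refine hperm _ hL (Submodule.subset_span ⟨(0, 0, e), ?_, ?_⟩)
    · have := hL.length_eq
      rw [length_word, Exponents.degree_leading] at this
      exact this.ge
    · simp only [centralMul, pow_zero, one_mul, monomial_eq_ordProd]
      rfl

theorem finite_degree_le (d : ℕ) : Finite {a : Fin 8 →₀ ℕ // a.degree ≤ d} := by
  refine Finite.of_injective (β := Fin 8 → Fin (d + 1))
    (fun a m => ⟨a.1 m, Nat.lt_succ_of_le ((Finsupp.le_degree m a.1).trans a.2)⟩) ?_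
  intro a b h
  ext m
  simpa using congrFun h m

/-- The span of `g` contains an independent family at least as large as κ, so its dimension is at
least the number of its generators. -/
theorem linearIndependent_of_forall_mem_span {K V ι κ : Type*} [Field K] [AddCommGroup V]
    [Module K V] [Finite ι] {f : ι → V} {g : κ → V} (hf : LinearIndependent K f) (i : κ → ι)
    (hi : Function.Injective i) (h : ∀ j, f j ∈ Submodule.span K (Set.range g)) :
    LinearIndependent K g := by
  have := Fintype.ofFinite ι
  have := Finite.of_injective i hi
  have := Fintype.ofFinite κ
  rw [linearIndependent_iff_card_le_finrank_span]
  refine (Fintype.card_le_of_injective i hi).trans ?_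
  rw [← finrank_span_eq_card hf]
  have : FiniteDimensional K (Submodule.span K (Set.range g)) :=
    FiniteDimensional.span_of_finite K (Set.finite_range _)
  refine Submodule.finrank_mono (Submodule.span_le.2 ?_)
  rintro _ ⟨a, rfl⟩
  exact h a

theorem linearIndependent_of_forall_le {K V ι : Type*} [Field K] [AddCommGroup V] [Module K V]
    {v : ι → V} (deg : ι → ℕ) (h : ∀ d, LinearIndependent K fun t : {t // deg t ≤ d} => v t.1) :
    LinearIndependent K v := by
  rw [linearIndependent_iff_finset_linearIndependent]
  intro s
  let f : s → {t // deg t ≤ s.sup deg} := fun t => ⟨t.1, Finset.le_sup t.2⟩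
  have hf : Function.Injective f := fun t t' ht => Subtype.ext (congrArg (fun x => x.1) ht)
  exact (h (s.sup deg)).comp f hf

theorem linearIndependent_centralMul_degree_le (d : ℕ) :
    LinearIndependent ℂ fun t : {t // centralDeg t ≤ d} => centralMul t.1 := by
  have := finite_degree_le d
  have hli : LinearIndependent ℂ fun a : {a : Fin 8 →₀ ℕ // a.degree ≤ d} => ordProd a.1 :=
    linearIndependent_ordProd.comp _ Subtype.val_injective
  let f : {t // centralDeg t ≤ d} → {a : Fin 8 →₀ ℕ // a.degree ≤ d} := fun t =>
    ⟨t.1.2.2.leading t.1.1 t.1.2.1, by rw [Exponents.degree_leading]; exact t.2⟩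
  have hf : Function.Injective f := fun t t' h =>
    Subtype.ext (Exponents.leading_injective (congrArg Subtype.val h))
  refine linearIndependent_of_forall_mem_span hli f hf fun a => ?_
  have h := prod_mem_centralSpan (word a.1)
  rw [length_word] at h
  have := centralSpan_mono a.2 h
  rw [centralSpan, Set.image_eq_range] at this
  exact this

theorem linearIndependent_centralMul : LinearIndependent ℂ centralMul :=
  linearIndependent_of_forall_le centralDeg linearIndependent_centralMul_degree_le

theorem span_centralMul : Submodule.span ℂ (Set.range centralMul) = ⊤ := by
  refine eq_top_iff.2 fun u _ => ?_
  obtain ⟨d, hd⟩ := exists_mem_filt u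
  refine (lowerSpan_le (P := Submodule.span ℂ (Set.range centralMul)) fun L _ _ => ?_) hd
  exact Submodule.span_mono (Set.image_subset_range _ _) (prod_mem_centralSpan L)

/-! ### Poisson invariants and evaluation at matrices -/

/-- The Poisson bracket with a generator on `S`. -/
def poisson (i : Fin 8) : Derivation ℂ S S :=
  MvPolynomial.mkDerivation ℂ fun j => ∑ k, (structConst i j k : ℂ) • X k

theorem poisson_X (i j : Fin 8) : poisson i (X j) = ∑ k, (structConst i j k : ℂ) • X k := by
  simp [poisson]

/-- The elements of `S` which Poisson-commute with everything. -/
def IsInvariant (p : S) : Prop := ∀ i, poisson i p = 0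

section Point

variable {K : Type*} [CommRing K]

/-- The standard basis of `sl3` with entries in an arbitrary ring. -/
def genMat (K : Type*) [CommRing K] (i : Fin 8) : Matrix (Fin 3) (Fin 3) K :=
  (genInt i).map (Int.castRingHom K)

/-- Conjugation by the unipotent matrix `1 + c * genMat i`, if `genMat i` has square zero. -/
def transv (i : Fin 8) (c : K) (B : Matrix (Fin 3) (Fin 3) K) : Matrix (Fin 3) (Fin 3) K :=
  (1 + c • genMat K i) * B * (1 - c • genMat K i)

theorem genMat_map {K' : Type*} [CommRing K'] (f : K →+* K') (i : Fin 8) :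
    (genMat K i).map f = genMat K' i := by
  ext a b
  simp [genMat]

theorem transv_map {K' : Type*} [CommRing K'] (f : K →+* K') (i : Fin 8) (c : K)
    (B : Matrix (Fin 3) (Fin 3) K) : (transv i c B).map f = transv i (f c) (B.map f) := by
  have h : (c • genMat K i).map f = f c • genMat K' i := by
    rw [← genMat_map f]
    ext a b
    simp
  rw [transv, transv, Matrix.map_mul, Matrix.map_mul, Matrix.map_add _ (by simp),
    Matrix.map_sub _ (by simp), h, Matrix.map_one _ (by simp) (by simp)]

theorem genInt_mul_self : ∀ i : Fin 8, i.val < 6 → genInt i * genInt i = 0 := by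
  decide

theorem genMat_mul_self {i : Fin 8} (hi : i.val < 6) : genMat K i * genMat K i = 0 := by
  rw [genMat, ← Matrix.map_mul, genInt_mul_self i hi]
  simp

theorem genInt_commutator : ∀ i j : Fin 8, genInt i * genInt j - genInt j * genInt i =
    ∑ k, structConst i j k • genInt k := by
  decide +kernel

theorem genMat_commutator (i j : Fin 8) : genMat K i * genMat K j - genMat K j * genMat K i =
    ∑ k, (structConst i j k : K) • genMat K k := by
  rw [genMat, genMat, ← Matrix.map_mul, ← Matrix.map_mul, ← Matrix.map_sub _ (by simp),
    genInt_commutator]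
  ext a b
  simp [Matrix.sum_apply, genMat, -zsmul_eq_mul]

variable [Algebra ℂ K]

/-- Evaluation of elements of `S` at a matrix, through the trace form. -/
def evalAt (B : Matrix (Fin 3) (Fin 3) K) : S →ₐ[ℂ] K :=
  MvPolynomial.aeval fun k => (genMat K k * B).trace

theorem evalAt_X (B : Matrix (Fin 3) (Fin 3) K) (k : Fin 8) :
    evalAt B (X k) = (genMat K k * B).trace := by
  simp [evalAt]

theorem evalAt_map {K' : Type*} [CommRing K'] [Algebra ℂ K'] (f : K →ₐ[ℂ] K')
    (B : Matrix (Fin 3) (Fin 3) K) (p : S) :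
    evalAt (B.map f) p = f (evalAt B p) := by
  have : evalAt (B.map f) = f.comp (evalAt B) := by
    refine MvPolynomial.algHom_ext fun k => ?_
    rw [AlgHom.comp_apply, evalAt_X, evalAt_X, ← genMat_map (f : K →+* K')]
    simp [Matrix.trace, Matrix.mul_apply]
  rw [this, AlgHom.comp_apply]

/-- Cyclicity of the trace moves the bracket from B to the generator, which produces the sign. -/
theorem trace_commutator (i j : Fin 8) (B : Matrix (Fin 3) (Fin 3) K) :
    (genMat K j * (genMat K i * B - B * genMat K i)).trace = - evalAt B (poisson i (X j)) := by
  have h : (genMat K j * (genMat K i * B - B * genMat K i)).trace =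
      -((genMat K i * genMat K j - genMat K j * genMat K i) * B).trace := by
    rw [mul_sub, sub_mul, Matrix.trace_sub, Matrix.trace_sub, ← mul_assoc, ← mul_assoc,
      Matrix.trace_mul_comm (genMat K j * B), ← mul_assoc]
    ring
  rw [h, genMat_commutator, poisson_X, map_sum, Finset.sum_mul, Matrix.trace_sum]
  congr 1
  refine Finset.sum_congr rfl fun k _ => ?_
  rw [map_smul, evalAt_X, Matrix.smul_mul, Matrix.trace_smul, Int.cast_smul_eq_zsmul,
    Int.cast_smul_eq_zsmul]

end Point

/-! ### Invariance under unipotent conjugation -/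

section Flow

open Polynomial (derivative)

variable {K : Type*} [Field K]

/-- The orbit of a matrix under a one-parameter group of unipotent matrices. -/
def orbit (i : Fin 8) (B : Matrix (Fin 3) (Fin 3) K) : Matrix (Fin 3) (Fin 3) (Polynomial K) :=
  transv i Polynomial.X (B.map Polynomial.C)

/-- For i < 6 the generator E has square zero, so 1 ± tE = exp(±tE) and the orbit solves the
equation of the adjoint flow. -/
theorem derivative_orbit {i : Fin 8} (hi : i.val < 6) (B : Matrix (Fin 3) (Fin 3) K) :
    (orbit i B).map derivative = genMat _ i * orbit i B - orbit i B * genMat _ i := by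
  set E := genMat (Polynomial K) i with hE
  have hE2 : E * E = 0 := genMat_mul_self hi
  set B' := B.map Polynomial.C with hB'
  have h₁ : orbit i B = B' + (Polynomial.X : Polynomial K) • (E * B' - B' * E) -
      (Polynomial.X ^ 2 : Polynomial K) • (E * B' * E) := by
    rw [orbit, transv, ← hE, ← hB']
    simp only [add_mul, mul_sub, one_mul, mul_one, Matrix.smul_mul, Matrix.mul_smul, smul_smul,
      smul_sub, pow_two, mul_assoc]
    abel
  have h₂ : E * orbit i B - orbit i B * E =
      (E * B' - B' * E) - (2 * Polynomial.X : Polynomial K) • (E * B' * E) := by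
    have h₃ : ∀ M, E * (E * M) = 0 := fun M => by rw [← mul_assoc, hE2, zero_mul]
    rw [h₁]
    simp only [mul_add, add_mul, mul_sub, sub_mul, Matrix.smul_mul, Matrix.mul_smul, mul_assoc,
      hE2, h₃, mul_zero, smul_zero, two_mul, add_smul, smul_sub]
    abel
  have h₄ : E * B' - B' * E = (genMat K i * B - B * genMat K i).map Polynomial.C := by
    rw [Matrix.map_sub _ (by simp), Matrix.map_mul, Matrix.map_mul, genMat_map]
  have h₅ : E * B' * E = (genMat K i * B * genMat K i).map Polynomial.C := by
    rw [Matrix.map_mul, Matrix.map_mul, genMat_map]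
  rw [h₂, h₁, h₄, h₅]
  ext1 a b
  simp only [Matrix.map_apply, Matrix.sub_apply, Matrix.add_apply, Matrix.smul_apply, smul_eq_mul,
    map_sub, map_add, Polynomial.derivative_mul, Polynomial.derivative_X, Polynomial.derivative_C,
    Polynomial.derivative_X_pow, hB']
  simp
  exact Or.inl (map_ofNat Polynomial.C 2)

variable [Algebra ℂ K]

theorem derivative_evalAt_orbit {i : Fin 8} (hi : i.val < 6) (B : Matrix (Fin 3) (Fin 3) K)
    (p : S) : derivative (evalAt (orbit i B) p) = -evalAt (orbit i B) (poisson i p) := by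
  induction p using MvPolynomial.induction_on with
  | C a =>
    rw [MvPolynomial.derivation_C, map_zero, neg_zero, ← MvPolynomial.algebraMap_eq,
      AlgHom.commutes, IsScalarTower.algebraMap_apply ℂ K (Polynomial K)]
    exact Polynomial.derivative_C
  | add p q hp hq => simp only [map_add, hp, hq, neg_add]
  | mul_X p k hp =>
    have hk : derivative (evalAt (orbit i B) (X k)) =
        -evalAt (orbit i B) (poisson i (X k)) := by
      rw [← trace_commutator, ← derivative_orbit hi, evalAt_X]
      simp only [Matrix.trace, Matrix.diag_apply, Matrix.mul_apply, map_sum,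
        Polynomial.derivative_mul, Matrix.map_apply]
      simp [genMat]
    rw [map_mul, Polynomial.derivative_mul, hp, hk, Derivation.leibniz, map_add, smul_eq_mul,
      smul_eq_mul, map_mul, map_mul]
    ring

/-- Along the orbit the value is a polynomial in the parameter with zero derivative; in
characteristic zero it equals its value at 0. -/
theorem evalAt_transv {i : Fin 8} (hi : i.val < 6) (c : K) (B : Matrix (Fin 3) (Fin 3) K) {p : S}
    (hp : IsInvariant p) : evalAt (transv i c B) p = evalAt B p := by
  have : CharZero K := charZero_of_injective_algebraMap (algebraMap ℂ K).injective
  have hev : ∀ t : K, Polynomial.eval t (evalAt (orbit i B) p) = evalAt (transv i t B) p := by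
    intro t
    have := evalAt_map ((Polynomial.aeval t : Polynomial K →ₐ[K] K).restrictScalars ℂ)
      (orbit i B) p
    rw [AlgHom.restrictScalars_apply, Polynomial.coe_aeval_eq_eval] at this
    have h := transv_map (Polynomial.evalRingHom t) i Polynomial.X (B.map Polynomial.C)
    rw [Polynomial.coe_evalRingHom, Polynomial.eval_X, Matrix.map_map] at h
    have h' : (Polynomial.eval t ∘ Polynomial.C) = (id : K → K) := by ext; simp
    rw [h', Matrix.map_id] at h
    rw [← this, ← h]
    congr 3
  have hd : derivative (evalAt (orbit i B) p) = 0 := by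
    rw [derivative_evalAt_orbit hi, hp i, map_zero, neg_zero]
  rw [← hev, Polynomial.eq_C_of_derivative_eq_zero hd, Polynomial.eval_C]
  rw [Polynomial.coeff_zero_eq_eval_zero, hev]
  simp [transv]

end Flow

/-! ### Reduction to a transversal slice -/

section Slice

variable {K : Type*} [Field K]

theorem transv_one (s a b c d e f g h i : K) : transv 1 s !![a, b, c; d, e, f; g, h, i] =
    !![a, b - s * c, c; d, e - s * f, f; g + s * d, h + s * e - s * (i + s * f), i + s * f] := by
  ext m n
  fin_cases m <;> fin_cases n <;>
    simp [transv, genMat, genInt, Matrix.mul_apply, Fin.sum_univ_three, Matrix.one_apply] <;> ring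

theorem transv_three (s a b c d e f g h i : K) : transv 3 s !![a, b, c; d, e, f; g, h, i] =
    !![a + s * d, b + s * e - s * (a + s * d), c + s * f; d, e - s * d, f; g, h - s * g, i] := by
  ext m n
  fin_cases m <;> fin_cases n <;>
    simp [transv, genMat, genInt, Matrix.mul_apply, Fin.sum_univ_three, Matrix.one_apply] <;> ring

theorem transv_four (s a b c d e f g h i : K) : transv 4 s !![a, b, c; d, e, f; g, h, i] =
    !![a, b, c - s * b; d + s * g, e + s * h, f + s * i - s * (e + s * h); g, h, i - s * h] := by
  ext m n
  fin_cases m <;> fin_cases n <;>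
    simp [transv, genMat, genInt, Matrix.mul_apply, Fin.sum_univ_three, Matrix.one_apply] <;> ring

theorem transv_five (s a b c d e f g h i : K) : transv 5 s !![a, b, c; d, e, f; g, h, i] =
    !![a + s * g, b + s * h, c + s * i - s * (a + s * g); d, e, f - s * d; g, h, i - s * g] := by
  ext m n
  fin_cases m <;> fin_cases n <;>
    simp [transv, genMat, genInt, Matrix.mul_apply, Fin.sum_univ_three, Matrix.one_apply] <;> ring

variable [Algebra ℂ K]

/-- Two matrices at which all invariants, and all traces of powers, agree. -/
structure SameInvariants (A B : Matrix (Fin 3) (Fin 3) K) : Prop where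
  evalAt_eq : ∀ p, IsInvariant p → evalAt A p = evalAt B p
  trace_pow_eq : ∀ n, (A ^ n).trace = (B ^ n).trace

theorem SameInvariants.trans {A B D : Matrix (Fin 3) (Fin 3) K} (h : SameInvariants A B)
    (h' : SameInvariants B D) : SameInvariants A D :=
  ⟨fun p hp => (h.1 p hp).trans (h'.1 p hp), fun n => (h.2 n).trans (h'.2 n)⟩

theorem sameInvariants_transv {i : Fin 8} (hi : i.val < 6) (c : K) (A : Matrix (Fin 3) (Fin 3) K) :
    SameInvariants A (transv i c A) := by
  refine ⟨fun p hp => (evalAt_transv hi c A hp).symm, fun n => ?_⟩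
  have h : (1 - c • genMat K i) * (1 + c • genMat K i) = 1 := by
    rw [sub_mul, mul_add, mul_add]
    simp only [Matrix.smul_mul, Matrix.mul_smul, genMat_mul_self hi]
    simp
  have h' : transv i c A ^ n = (1 + c • genMat K i) * A ^ n * (1 - c • genMat K i) := by
    induction n with
    | zero => rw [pow_zero, pow_zero, mul_one, mul_eq_one_comm.1 h]
    | succ n ih =>
      rw [pow_succ, ih, transv, pow_succ]
      simp only [mul_assoc]
      rw [← mul_assoc (1 - _) (1 + _), h, one_mul]
  rw [h', Matrix.trace_mul_comm, ← mul_assoc, h, one_mul]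

/-- The quantity in `hdet` is det(v, Av, A²v) for the first basis vector v. The first three
conjugations, along E₂₃, E₁₂ and E₃₂, fix v and so preserve it; once the first column is (0, 1, 0)
it is the entry h₃, which can then be divided by to clear the remaining entries. -/
theorem exists_sameInvariants_companion (a b c d e f g h i : K) (hg : g ≠ 0)
    (hdet : h * d ^ 2 + (i - e) * d * g - f * g ^ 2 ≠ 0) (ht : a + e + i = 0) :
    ∃ x y z : K, SameInvariants !![a, b, c; d, e, f; g, h, i] !![0, 0, x; 1, 0, y; 0, z, 0] := by
  obtain ⟨b₁, c₁, e₁, f₁, h₁, i₁, s₁, ht₁, hd₁⟩ : ∃ b₁ c₁ e₁ f₁ h₁ i₁ : K,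
      SameInvariants !![a, b, c; d, e, f; g, h, i] !![a, b₁, c₁; 1, e₁, f₁; g, h₁, i₁] ∧
      a + e₁ + i₁ = 0 ∧ h₁ + (i₁ - e₁) * g - f₁ * g ^ 2 ≠ 0 := by
    have hs := sameInvariants_transv (i := 4) (by decide) ((1 - d) / g)
      !![a, b, c; d, e, f; g, h, i]
    rw [transv_four] at hs
    have hd : d + (1 - d) / g * g = 1 := by field_simp; ring
    rw [hd] at hs
    refine ⟨_, _, _, _, _, _, hs, ?_, ?_⟩
    · linear_combination ht
    · convert hdet using 1
      field_simp
      ring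
  obtain ⟨b₂, c₂, e₂, f₂, h₂, i₂, s₂, ht₂, hd₂⟩ : ∃ b₂ c₂ e₂ f₂ h₂ i₂ : K,
      SameInvariants !![a, b, c; d, e, f; g, h, i] !![0, b₂, c₂; 1, e₂, f₂; g, h₂, i₂] ∧
      e₂ + i₂ = 0 ∧ h₂ + (i₂ - e₂) * g - f₂ * g ^ 2 ≠ 0 := by
    have hs := sameInvariants_transv (i := 3) (by decide) (-a)
      !![a, b₁, c₁; 1, e₁, f₁; g, h₁, i₁]
    rw [transv_three] at hs
    have ha : a + -a * 1 = 0 := by ring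
    rw [ha] at hs
    refine ⟨_, _, _, _, _, _, s₁.trans hs, ?_, ?_⟩
    · linear_combination ht₁
    · convert hd₁ using 1
      ring
  obtain ⟨b₃, c₃, e₃, f₃, h₃, i₃, s₃, ht₃, hd₃⟩ : ∃ b₃ c₃ e₃ f₃ h₃ i₃ : K,
      SameInvariants !![a, b, c; d, e, f; g, h, i] !![0, b₃, c₃; 1, e₃, f₃; 0, h₃, i₃] ∧
      e₃ + i₃ = 0 ∧ h₃ ≠ 0 := by
    have hs := sameInvariants_transv (i := 1) (by decide) (-g)
      !![0, b₂, c₂; 1, e₂, f₂; g, h₂, i₂]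
    rw [transv_one] at hs
    have hg' : g + -g * 1 = 0 := by ring
    rw [hg'] at hs
    refine ⟨_, _, _, _, _, _, s₂.trans hs, ?_, ?_⟩
    · linear_combination ht₂
    · convert hd₂ using 1
      ring
  obtain ⟨c₄, e₄, f₄, s₄, ht₄⟩ : ∃ c₄ e₄ f₄ : K,
      SameInvariants !![a, b, c; d, e, f; g, h, i] !![0, 0, c₄; 1, e₄, f₄; 0, h₃, i₃] ∧
      e₄ + i₃ = 0 := by
    have hs := sameInvariants_transv (i := 5) (by decide) (-(b₃ / h₃))
      !![0, b₃, c₃; 1, e₃, f₃; 0, h₃, i₃]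
    rw [transv_five] at hs
    have hb : b₃ + -(b₃ / h₃) * h₃ = 0 := by field_simp; ring
    simp only [hb, mul_zero, add_zero, sub_zero] at hs
    exact ⟨_, _, _, s₃.trans hs, ht₃⟩
  have hs := sameInvariants_transv (i := 4) (by decide) (-(e₄ / h₃))
    !![0, 0, c₄; 1, e₄, f₄; 0, h₃, i₃]
  rw [transv_four] at hs
  have he : e₄ + -(e₄ / h₃) * h₃ = 0 := by field_simp; ring
  have hi : i₃ - -(e₄ / h₃) * h₃ = 0 := by field_simp; linear_combination ht₄
  simp only [he, hi, mul_zero, add_zero, sub_zero] at hs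
  exact ⟨_, _, _, s₄.trans hs⟩

end Slice

theorem derivation_monomial_of_weights (D : Derivation ℂ S S) (w : Fin 8 → ℂ)
    (hD : ∀ i, D (X i) = w i • X i) (a : Fin 8 →₀ ℕ) :
    D (MvPolynomial.monomial a 1) = (∑ i, a i * w i) • MvPolynomial.monomial a (1 : ℂ) := by
  induction a using Finsupp.induction_linear with
  | zero => simp
  | add a b ha hb =>
    rw [← one_mul (1 : ℂ), ← MvPolynomial.monomial_mul, Derivation.leibniz, ha, hb]
    simp only [Finsupp.add_apply, Nat.cast_add, add_mul, Finset.sum_add_distrib, add_smul,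
      smul_eq_mul, mul_smul_comm]
    rw [mul_comm (MvPolynomial.monomial b 1), add_comm]
  | single i n =>
    rw [← MvPolynomial.X_pow_eq_monomial, Derivation.leibniz_pow, hD]
    rcases n with _ | n
    · simp
    · rw [Finset.sum_eq_single i (by intro j _ hj; simp [hj.symm]) (by simp)]
      simp only [Finsupp.single_eq_same, Nat.add_sub_cancel, smul_eq_mul, mul_smul_comm,
        ← pow_succ, mul_smul, Nat.cast_smul_eq_nsmul]

theorem coeff_derivation_of_weights (D : Derivation ℂ S S) (w : Fin 8 → ℂ)
    (hD : ∀ i, D (X i) = w i • X i) (p : S) (a : Fin 8 →₀ ℕ) :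
    MvPolynomial.coeff a (D p) = (∑ i, a i * w i) * MvPolynomial.coeff a p := by
  induction p using MvPolynomial.induction_on' with
  | monomial b c =>
    have h : MvPolynomial.monomial b c = c • MvPolynomial.monomial b (1 : ℂ) := by
      simp [MvPolynomial.smul_monomial]
    rw [h, Derivation.map_smul, derivation_monomial_of_weights D w hD]
    simp only [MvPolynomial.coeff_smul, MvPolynomial.coeff_monomial]
    split_ifs with hab
    · subst hab; simp [mul_comm]
    · simp
  | add p q hp hq => rw [map_add, MvPolynomial.coeff_add, hp, hq, MvPolynomial.coeff_add, mul_add]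

/-- H₁ + 2H₂ = diag(1, 1, -2) acts with weight -3 on Y₂ and Y₃, 3 on X₂ and X₃, and 0 on the rest;
monomials of an invariant have total weight 0. -/
theorem IsInvariant.weight_eq {p : S} (hp : IsInvariant p) {a : Fin 8 →₀ ℕ} (ha : a ∈ p.support) :
    a 1 + a 2 = a 4 + a 5 := by
  have hw : ∀ j k, structConst 6 j k + 2 * structConst 7 j k =
      if j = k then ![0, -3, -3, 0, 3, 3, 0, 0] j else 0 := by decide
  have h := coeff_derivation_of_weights (poisson 6 + (2 : ℂ) • poisson 7)
    (fun j => ((![0, -3, -3, 0, 3, 3, 0, 0] j : ℤ) : ℂ)) (fun j => by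
      rw [Derivation.add_apply, Derivation.smul_apply, poisson_X, poisson_X, Finset.smul_sum,
        ← Finset.sum_add_distrib, Finset.sum_eq_single j]
      · have := congrArg (Int.cast (R := ℂ)) (hw j j)
        rw [if_pos rfl] at this
        rw [← this, smul_smul, ← add_smul]
        push_cast
        rfl
      · intro k _ hk
        have := congrArg (Int.cast (R := ℂ)) (hw j k)
        rw [if_neg hk.symm] at this
        rw [smul_smul, ← add_smul]
        push_cast at this
        rw [this, zero_smul]
      · simp) p a
  rw [Derivation.add_apply, Derivation.smul_apply, hp 6, hp 7, smul_zero, add_zero,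
    MvPolynomial.coeff_zero, eq_comm, mul_eq_zero] at h
  have h := h.resolve_right (MvPolynomial.mem_support_iff.1 ha)
  rw [Fin.sum_univ_eight] at h
  simp at h
  have h' : ((a 1 + a 2 : ℕ) : ℂ) = ((a 4 + a 5 : ℕ) : ℂ) := by
    push_cast
    linear_combination (-1 / 3 : ℂ) * h
  exact_mod_cast h'

/-- The restriction of `p` to a transversal slice, in terms of the invariants. -/
def sliceRestrict : S →ₐ[ℂ] MvPolynomial (Fin 2) ℂ :=
  MvPolynomial.aeval ![0, C (1 / 2) * X 0, C (1 / 3) * X 1, 1, 1, 0, 0, 0]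

/-- On the slice Y₂, Y₃, X₁, X₂ take the values y, x, 1, z and the others vanish. Weight balance
pairs each y or x with one z, leaving a polynomial in yz and xz, which are 1/2 and 1/3 of the two
traces. -/
theorem evalAt_companion {K : Type*} [Field K] [Algebra ℂ K] (x y z : K) {p : S}
    (hp : IsInvariant p) :
    evalAt !![0, 0, x; 1, 0, y; 0, z, 0] p =
      MvPolynomial.aeval ![(!![0, 0, x; 1, 0, y; 0, z, 0] ^ 2).trace,
        (!![0, 0, x; 1, 0, y; 0, z, 0] ^ 3).trace] (sliceRestrict p) := by
  have : CharZero K := charZero_of_injective_algebraMap (algebraMap ℂ K).injective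
  have h₂ : (!![0, 0, x; 1, 0, y; 0, z, 0] ^ 2).trace = 2 * (y * z) := by
    simp [pow_succ, Matrix.trace, Fin.sum_univ_three]
    ring
  have h₃ : (!![0, 0, x; 1, 0, y; 0, z, 0] ^ 3).trace = 3 * (x * z) := by
    simp [pow_succ, Matrix.trace, Fin.sum_univ_three]
    ring
  rw [h₂, h₃]
  have hl : evalAt !![0, 0, x; 1, 0, y; 0, z, 0] =
      (MvPolynomial.aeval ![0, y, x, 1, z, 0, 0, 0] : S →ₐ[ℂ] K) := by
    refine MvPolynomial.algHom_ext fun k => ?_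
    rw [evalAt_X, MvPolynomial.aeval_X]
    fin_cases k <;>
      simp [genMat, genInt, Matrix.trace, Fin.sum_univ_three, Matrix.mul_apply]
  have hr : (MvPolynomial.aeval ![2 * (y * z), 3 * (x * z)]).comp sliceRestrict =
      (MvPolynomial.aeval ![0, y * z, x * z, 1, 1, 0, 0, 0] : S →ₐ[ℂ] K) := by
    refine MvPolynomial.algHom_ext fun k => ?_
    rw [AlgHom.comp_apply, sliceRestrict, MvPolynomial.aeval_X, MvPolynomial.aeval_X]
    have h2 : algebraMap ℂ K 2 = 2 := map_ofNat _ 2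
    have h3 : algebraMap ℂ K 3 = 3 := map_ofNat _ 3
    fin_cases k <;> simp [h2, h3]
  rw [← AlgHom.comp_apply, hr, hl, MvPolynomial.aeval_def, MvPolynomial.aeval_def,
    MvPolynomial.eval₂_eq', MvPolynomial.eval₂_eq']
  refine Finset.sum_congr rfl fun a ha => ?_
  have hw := hp.weight_eq ha
  rw [Fin.prod_univ_eight, Fin.prod_univ_eight]
  by_cases h5 : a 5 = 0
  · rw [h5, add_zero] at hw
    simp [← hw, pow_add, mul_pow]
    ring_nf
    simp
  · simp [h5]

/-- The generic trace-zero matrix over `S`. -/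
def symMat : Matrix (Fin 3) (Fin 3) S :=
  !![(2 / 3 : ℂ) • X 6 + (1 / 3 : ℂ) • X 7, X 3, X 5;
    X 0, (-1 / 3 : ℂ) • X 6 + (1 / 3 : ℂ) • X 7, X 4;
    X 2, X 1, (-1 / 3 : ℂ) • X 6 + (-2 / 3 : ℂ) • X 7]

/-- The trace form pairs E_{ij} with the entry (j, i), hence the transpose. -/
theorem evalAt_symMat_transpose (p : S) : evalAt symMat.transpose p = p := by
  have : evalAt symMat.transpose = AlgHom.id ℂ S := by
    refine MvPolynomial.algHom_ext fun k => ?_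
    rw [evalAt_X]
    fin_cases k <;>
      simp [genMat, genInt, Matrix.trace, Fin.sum_univ_three, Matrix.mul_apply, symMat] <;> module
  rw [this, AlgHom.id_apply]

/-- Invariants are polynomials in the traces of the square and the cube of the generic matrix. -/
theorem IsInvariant.eq_aeval {p : S} (hp : IsInvariant p) :
    p = MvPolynomial.aeval ![(symMat ^ 2).trace, (symMat ^ 3).trace] (sliceRestrict p) := by
  -- Over the fraction field the generic matrix itself can be moved to the slice, and evaluation at
  -- it loses nothing.
  let K := FractionRing S
  let f : S →ₐ[ℂ] K := IsScalarTower.toAlgHom ℂ S K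
  have hf : Function.Injective f := IsFractionRing.injective S K
  apply hf
  have htr : ∀ n, ((symMat.transpose.map f) ^ n).trace = f (symMat ^ n).trace := by
    intro n
    have h : symMat.transpose.map f ^ n = ((symMat ^ n).map f).transpose := by
      rw [Matrix.transpose_map, ← Matrix.transpose_pow]
      exact congrArg Matrix.transpose (Matrix.map_pow symMat (f : S →+* K) n).symm
    rw [h, Matrix.trace_transpose]
    simp [Matrix.trace]
  obtain ⟨x, y, z, h⟩ := exists_sameInvariants_companion (f (symMat 0 0)) (f (symMat 1 0))
    (f (symMat 2 0)) (f (symMat 0 1)) (f (symMat 1 1)) (f (symMat 2 1)) (f (symMat 0 2))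
    (f (symMat 1 2)) (f (symMat 2 2)) (by
      rw [Ne, map_eq_zero_iff f hf]
      exact MvPolynomial.X_ne_zero _) (by
      simp only [← map_mul, ← map_sub, ← map_add, ← map_pow]
      rw [Ne, map_eq_zero_iff f hf]
      -- At X₁ = X₂ = 1 and all other variables 0 the quantity equals 1.
      intro h
      have := congrArg (MvPolynomial.eval ![0, 0, 0, 1, 1, 0, 0, 0]) h
      simp [symMat] at this) (by
      rw [← map_add, ← map_add]
      convert map_zero f
      simp [symMat]
      module)
  have hA : !![f (symMat 0 0), f (symMat 1 0), f (symMat 2 0); f (symMat 0 1), f (symMat 1 1),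
      f (symMat 2 1); f (symMat 0 2), f (symMat 1 2), f (symMat 2 2)] =
      symMat.transpose.map f := by
    ext i j
    fin_cases i <;> fin_cases j <;> rfl
  rw [hA] at h
  have h₁ := h.evalAt_eq p hp
  rw [evalAt_map, evalAt_symMat_transpose, evalAt_companion x y z hp, ← h.trace_pow_eq,
    ← h.trace_pow_eq, htr, htr] at h₁
  have hcomp : f.comp (MvPolynomial.aeval ![(symMat ^ 2).trace, (symMat ^ 3).trace]) =
      MvPolynomial.aeval ![f (symMat ^ 2).trace, f (symMat ^ 3).trace] := by
    refine MvPolynomial.algHom_ext fun k => ?_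
    rw [AlgHom.comp_apply, MvPolynomial.aeval_X, MvPolynomial.aeval_X]
    fin_cases k <;> rfl
  rw [h₁, ← hcomp, AlgHom.comp_apply]

/-! ### Symbols of central elements and the structure of the center -/

theorem gen_mem_filt (i : Fin 8) : gen i ∈ filt 2 := by
  simpa using prod_mem_lowerSpan (g := gen) (w := fun _ => 0) (d := 2) (n := 1) [i]

theorem topSym_gen (i : Fin 8) : topSym 1 (gen i) = X i := by
  simpa using topSym_prod [i]

theorem commutator_prod (i : Fin 8) (L : List (Fin 8)) :
    gen i * (L.map gen).prod - (L.map gen).prod * gen i ∈ filt (L.length + 1) ∧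
      topSym L.length (gen i * (L.map gen).prod - (L.map gen).prod * gen i) =
        poisson i (L.map X).prod := by
  induction L with
  | nil => simp
  | cons j L ih =>
    have hj : gen i * gen j - gen j * gen i ∈ filt 2 :=
      lowerSpan_wt_le_filt _ _ (gen_commutator_mem_lowerSpan i j)
    have hP : (L.map gen).prod ∈ filt (L.length + 1) :=
      prod_mem_lowerSpan L (Nat.lt_succ_self _) (by simp)
    have h : gen i * ((j :: L).map gen).prod - ((j :: L).map gen).prod * gen i =
        (gen i * gen j - gen j * gen i) * (L.map gen).prod +
          gen j * (gen i * (L.map gen).prod - (L.map gen).prod * gen i) := by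
      simp only [List.map_cons, List.prod_cons]
      noncomm_ring
    rw [h, List.length_cons, add_comm L.length 1]
    refine ⟨add_mem (mul_mem_filt hj hP) (mul_mem_filt (gen_mem_filt j) ih.1), ?_⟩
    rw [map_add, topSym_mul (d := 1) hj hP, topSym_mul (d := 1) (gen_mem_filt j) ih.1, ih.2,
      topSym_prod, topSym_gen, gen_commutator, List.map_cons, List.prod_cons, Derivation.leibniz,
      poisson_X]
    simp only [map_sum, map_smul, topSym_gen, smul_eq_mul]
    ring

/-- Commuting with a generator does not raise the degree, and on symbols it becomes the Poisson
bracket; hence central elements have invariant symbols. -/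
theorem topSym_commutator (i : Fin 8) {d : ℕ} {u : U} (hu : u ∈ filt (d + 1)) :
    topSym d (gen i * u - u * gen i) = poisson i (topSym d u) := by
  induction hu using Submodule.span_induction with
  | mem x hx =>
    obtain ⟨L, hL, -, rfl⟩ := hx
    rw [topSym_prod_of_le L (by omega)]
    split_ifs with h
    · rw [← h, (commutator_prod i L).2]
    · rw [map_zero]
      exact topSym_eq_zero (by omega) (commutator_prod i L).1
  | zero => simp
  | add x y _ _ hx hy =>
    rw [map_add, map_add, ← hx, ← hy, ← map_add]
    congr 1
    noncomm_ring
  | smul c x _ hx =>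
    rw [map_smul, Derivation.map_smul, ← hx, ← map_smul, mul_smul_comm, smul_mul_assoc, smul_sub]

theorem isInvariant_topSym {d : ℕ} {z : U} (hz : z ∈ Z) (hd : z ∈ filt (d + 1)) :
    IsInvariant (topSym d z) := fun i => by
  rw [← topSym_commutator i hd, Subalgebra.mem_center_iff.1 hz (gen i), sub_self, map_zero]

theorem unitMat_mem_filt (i j : Fin 3) : unitMat i j ∈ filt 2 :=
  lowerSpan_wt_le_filt _ _ (unitMat_mem_lowerSpan i j)

theorem topSym_unitMat (i j : Fin 3) : topSym 1 (unitMat i j) = symMat i j := by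
  rw [unitMat_apply, toU_eq_sum, map_sum, Fin.sum_univ_eight]
  simp only [map_smul, topSym_gen]
  fin_cases i <;> fin_cases j <;>
    simp [coord, unitSl, Matrix.single, symMat] <;> module

theorem casimir₂_mem_filt : casimir₂ ∈ filt 3 := by
  rw [casimir₂, Matrix.trace]
  refine Submodule.sum_mem _ fun i _ => ?_
  rw [Matrix.diag_apply, Matrix.mul_apply]
  exact Submodule.sum_mem _ fun j _ =>
    mul_mem_filt (d := 1) (d' := 1) (unitMat_mem_filt _ _) (unitMat_mem_filt _ _)

theorem topSym_casimir₂ : topSym 2 casimir₂ = (symMat ^ 2).trace := by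
  simp only [casimir₂, Matrix.trace, Matrix.diag_apply, Matrix.mul_apply, map_sum, pow_two]
  refine Finset.sum_congr rfl fun i _ => Finset.sum_congr rfl fun j _ => ?_
  rw [topSym_mul (d := 1) (d' := 1) (unitMat_mem_filt _ _) (unitMat_mem_filt _ _),
    topSym_unitMat, topSym_unitMat]

theorem casimir₃_mem_filt : casimir₃ ∈ filt 4 := by
  rw [casimir₃, Matrix.trace]
  refine Submodule.sum_mem _ fun i _ => ?_
  rw [Matrix.diag_apply, Matrix.mul_apply]
  refine Submodule.sum_mem _ fun j _ => mul_mem_filt (d := 2) (d' := 1) ?_ (unitMat_mem_filt _ _)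
  rw [Matrix.mul_apply]
  exact Submodule.sum_mem _ fun j _ =>
    mul_mem_filt (d := 1) (d' := 1) (unitMat_mem_filt _ _) (unitMat_mem_filt _ _)

theorem topSym_casimir₃ : topSym 3 casimir₃ = (symMat ^ 3).trace := by
  simp only [casimir₃, Matrix.trace, Matrix.diag_apply, Matrix.mul_apply, map_sum, pow_succ,
    pow_zero, one_mul, Finset.sum_mul]
  refine Finset.sum_congr rfl fun i _ => Finset.sum_congr rfl fun j _ =>
    Finset.sum_congr rfl fun k _ => ?_
  rw [topSym_mul (d := 2) (d' := 1) (mul_mem_filt (d := 1) (d' := 1) (unitMat_mem_filt _ _)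
    (unitMat_mem_filt _ _)) (unitMat_mem_filt _ _), topSym_mul (d := 1) (d' := 1)
    (unitMat_mem_filt _ _) (unitMat_mem_filt _ _), topSym_unitMat, topSym_unitMat, topSym_unitMat]

theorem topSym_pow {d : ℕ} {u : U} (hu : u ∈ filt (d + 1)) (n : ℕ) :
    u ^ n ∈ filt (d * n + 1) ∧ topSym (d * n) (u ^ n) = topSym d u ^ n := by
  induction n with
  | zero =>
    refine ⟨?_, ?_⟩
    · simpa using prod_mem_lowerSpan (g := gen) (w := fun _ => 0) (d := 1) (n := 1) []
    · simpa using topSym_prod []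
  | succ n ih =>
    rw [pow_succ, pow_succ, Nat.mul_succ]
    exact ⟨mul_mem_filt ih.1 hu, by rw [topSym_mul ih.1 hu, ih.2]⟩

theorem casimir_pow_mem_filt (i k : ℕ) :
    casimir₂ ^ i * casimir₃ ^ k ∈ filt (2 * i + 3 * k + 1) :=
  mul_mem_filt (topSym_pow casimir₂_mem_filt i).1 (topSym_pow casimir₃_mem_filt k).1

theorem topSym_casimir_pow (i k : ℕ) : topSym (2 * i + 3 * k) (casimir₂ ^ i * casimir₃ ^ k) =
    (symMat ^ 2).trace ^ i * (symMat ^ 3).trace ^ k := by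
  rw [topSym_mul (topSym_pow casimir₂_mem_filt i).1 (topSym_pow casimir₃_mem_filt k).1,
    (topSym_pow casimir₂_mem_filt i).2, (topSym_pow casimir₃_mem_filt k).2, topSym_casimir₂,
    topSym_casimir₃]

/-- In the polynomial expressing `p` by the two traces, the traces are replaced by the Casimir
elements. Only terms of weighted degree d are kept; the others contribute nothing to the homogeneous
`p`. -/
theorem exists_eq_topSym {d : ℕ} {p : S} (hp : IsInvariant p) (hd : p.IsHomogeneous d) :
    ∃ y ∈ Submodule.span ℂ (Set.range fun t : ℕ × ℕ => casimir₂ ^ t.1 * casimir₃ ^ t.2),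
      y ∈ filt (d + 1) ∧ topSym d y = p := by
  set Q := sliceRestrict p
  refine ⟨∑ m ∈ Q.support with 2 * m 0 + 3 * m 1 = d,
    Q.coeff m • (casimir₂ ^ m 0 * casimir₃ ^ m 1), ?_, ?_, ?_⟩
  · exact Submodule.sum_mem _ fun m _ =>
      Submodule.smul_mem _ _ (Submodule.subset_span ⟨(m 0, m 1), rfl⟩)
  · refine Submodule.sum_mem _ fun m hm => Submodule.smul_mem _ _ ?_
    rw [← (Finset.mem_filter.1 hm).2]
    exact casimir_pow_mem_filt _ _
  · rw [map_sum]
    conv_rhs => rw [← MvPolynomial.homogeneousComponent_eq_self hd, hp.eq_aeval,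
      MvPolynomial.aeval_def, MvPolynomial.eval₂_eq', map_sum]
    rw [Finset.sum_filter]
    refine Finset.sum_congr rfl fun m _ => ?_
    have hh : ((symMat ^ 2).trace ^ m 0 * (symMat ^ 3).trace ^ m 1).IsHomogeneous
        (2 * m 0 + 3 * m 1) := by
      rw [← topSym_casimir_pow]
      exact isHomogeneous_topSym _ _
    rw [Fin.prod_univ_two, MvPolynomial.algebraMap_eq, MvPolynomial.homogeneousComponent_C_mul]
    simp only [Matrix.cons_val_zero, Matrix.cons_val_one]
    rw [MvPolynomial.homogeneousComponent_of_mem hh]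
    simp only [eq_comm (a := d)]
    split_ifs with h
    · rw [map_smul, ← h, topSym_casimir_pow, MvPolynomial.smul_eq_C_mul]
    · rw [mul_zero]

theorem span_casimir_pow_le_center :
    Submodule.span ℂ (Set.range fun t : ℕ × ℕ => casimir₂ ^ t.1 * casimir₃ ^ t.2) ≤
      Subalgebra.toSubmodule Z := by
  rw [Submodule.span_le]
  rintro _ ⟨t, rfl⟩
  exact show _ ∈ Z from mul_mem (pow_mem casimir₂_mem_center _) (pow_mem casimir₃_mem_center _)

/-- The center of `U` is spanned by the products of powers of the two Casimir elements. -/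
theorem mem_span_casimir_pow {z : U} (hz : z ∈ Z) :
    z ∈ Submodule.span ℂ (Set.range fun t : ℕ × ℕ => casimir₂ ^ t.1 * casimir₃ ^ t.2) := by
  obtain ⟨n, hn⟩ := exists_mem_filt z
  generalize n + 1 = d at hn
  induction d generalizing z with
  | zero =>
    have : z ∈ (⊥ : Submodule ℂ U) := lowerSpan_le (fun L hL _ => absurd hL (Nat.not_lt_zero _)) hn
    rw [(Submodule.mem_bot ℂ).1 this]
    exact zero_mem _
  | succ d ih =>
    -- `y` is central with the same symbol as `z`, so `z - y` is central of lower degree.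
    obtain ⟨y, hy, hyd, hyz⟩ := exists_eq_topSym (isInvariant_topSym hz hn)
      (isHomogeneous_topSym d z)
    have h := ih (sub_mem hz (span_casimir_pow_le_center hy))
      (mem_filt_of_topSym_eq_zero (sub_mem hn hyd) (by rw [map_sub, hyz, sub_self]))
    simpa using add_mem h hy

/-! ### The basis over the center -/

theorem linearIndependent_monomial : LinearIndependent Z monomial := by
  rw [linearIndependent_iff']
  intro s g hg
  -- Expanding the central coefficients in Casimir powers turns a relation over the center into a
  -- ℂ-relation among the independent `centralMul`.
  have hc : ∀ e, ∃ c : ℕ × ℕ →₀ ℂ,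
      c.sum (fun t a => a • (casimir₂ ^ t.1 * casimir₃ ^ t.2)) = (g e : U) := fun e =>
    Finsupp.mem_span_range_iff_exists_finsupp.1 (mem_span_casimir_pow (g e).2)
  choose c hc using hc
  let T := s.biUnion fun e => (c e).support
  have hT : ∀ e ∈ s, (g e : U) = ∑ t ∈ T, c e t • (casimir₂ ^ t.1 * casimir₃ ^ t.2) := by
    intro e he
    rw [← hc e]
    exact Finsupp.sum_of_support_subset _ (Finset.subset_biUnion_of_mem (fun e => (c e).support) he)
      _ (by simp)
  let f : Exponents × ℕ × ℕ → ℕ × ℕ × Exponents := fun t => (t.2.1, t.2.2, t.1)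
  have hf : Function.Injective f := by
    rintro ⟨e, i, k⟩ ⟨e', i', k'⟩ h
    simp only [f, Prod.mk.injEq] at h ⊢
    tauto
  have hli : LinearIndependent ℂ fun t => centralMul (f t) := linearIndependent_centralMul.comp f hf
  have hsum : ∑ t ∈ s ×ˢ T, c t.1 t.2 • centralMul (f t) = 0 := by
    rw [Finset.sum_product, ← hg]
    refine Finset.sum_congr rfl fun e he => ?_
    rw [Subalgebra.smul_def, smul_eq_mul, hT e he, Finset.sum_mul]
    exact Finset.sum_congr rfl fun t _ => (smul_mul_assoc _ _ _).symm
  have h := linearIndependent_iff'.1 hli (s ×ˢ T) (fun t => c t.1 t.2) hsum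
  intro e he
  apply Subtype.ext
  rw [hT e he]
  exact Finset.sum_eq_zero fun t ht => by
    rw [h (e, t) (Finset.mem_product.2 ⟨he, ht⟩), zero_smul]

theorem span_monomial : ⊤ ≤ Submodule.span Z (Set.range monomial) := by
  intro u _
  have h : Submodule.span ℂ (Set.range centralMul) ≤
      (Submodule.span Z (Set.range monomial)).restrictScalars ℂ := by
    rw [Submodule.span_le]
    rintro _ ⟨⟨i, k, e⟩, rfl⟩
    let z : Z := ⟨casimir₂ ^ i * casimir₃ ^ k,
      mul_mem (pow_mem casimir₂_mem_center _) (pow_mem casimir₃_mem_center _)⟩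
    exact Submodule.smul_mem _ z (Submodule.subset_span ⟨e, rfl⟩)
  rw [span_centralMul] at h
  exact h (Submodule.mem_top (x := u))

end SlThree

end

theorem mainTheorem4 :
    ∃ b : Module.Basis SlThree.Exponents SlThree.Z SlThree.U,
      ∀ e : SlThree.Exponents, b e = SlThree.monomial e :=
  ⟨Module.Basis.mk SlThree.linearIndependent_monomial SlThree.span_monomial, fun e =>
    Module.Basis.mk_apply _ _ e⟩
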